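/- Let $N\ge 3$, $1<p<N$ and $q_1,q_2>1$ (all real except the integer $N$), and write $B_R=\{x\in\mathbb{R}^N:|x|<R\}$. Assume: (A) $A:(0,\infty)\to(0,\infty)$ is continuous and there are real numbers $a_0,a_\infty\in(p-N,p]$ and $c_0,c_\infty>0$ such that $$c_0\le\liminf_{r\to0^+}\frac{A(r)}{r^{a_0}}\le\limsup_{r\to0^+}\frac{A(r)}{r^{a_0}}<\infty,\qquad c_\infty\le\liminf_{r\to+\infty}\frac{A(r)}{r^{a_\infty}}\le\limsup_{r\to+\infty}\frac{A(r)}{r^{a_\infty}}<\infty;$$ (V) $V:(0,\infty)\to[0,\infty)$ is measurable and $V\in L^1_{\rm loc}((0,\infty))$; (K) $K:(0,\infty)\to(0,\infty)$ is measurable and $K\in L^s_{\rm loc}((0,\infty))$ for some $s>1$. Let $S_A$ be the space of radial functions $\varphi\in C_c^\infty(\mathbb{R}^N)$ with $\|\varphi\|_A:=\left(\int_{\mathbb{R}^N}A(|x|)|\nabla\varphi|^p\,dx\right)^{1/p}<\infty$, and let $D_A$ be its completion with respect to $\|\cdot\|_A$, realised as the space of those functions (up to equality a.e.) that are a.e.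 limits of $\|\cdot\|_A$-Cauchy sequences of $S_A$; its norm is $\|u\|_A=\left(\int_{\mathbb{R}^N}A(|x|)|\nabla u|^p\,dx\right)^{1/p}$, where $\nabla u$ is the weak gradient of $u$ in $\mathbb{R}^N\setminus\{0\}$. Let $$X:=D_A\cap L^p(\mathbb{R}^N,V(|x|)\,dx),\qquad \|u\|:=\left(\|u\|_A^p+\int_{\mathbb{R}^N}V(|x|)|u|^p\,dx\right)^{1/p}.$$ For $q>1$ and $R>0$ define, with values in $[0,\infty]$, $$\mathcal{S}_0(q,R):=\sup_{u\in X,\ \|u\|=1}\int_{B_R}K(|x|)|u|^q\,dx,\qquad \mathcal{S}_\infty(q,R):=\sup_{u\in X,\ \|u\|=1}\int_{\mathbb{R}^N\setminus B_R}K(|x|)|u|^q\,dx.$$ Finally let $L_K^q:=L^q(\mathbb{R}^N,K(|x|)\,dx)$, and let $L_K^{q_1}+L_K^{q_2}$ be the space of all sums $u_1+u_2$ with $u_i\in L_K^{q_i}$, normed by $\|u\|:=\inf_{u_1+u_2=u}\max\{\|u_1\|_{L_K^{q_1}},\|u_2\|_{L_K^{q_2}}\}$. (i) If $\mathcal{S}_0(q_1,R_1)<\infty$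 and $\mathcal{S}_\infty(q_2,R_2)<\infty$ for some $R_1,R_2>0$, then $X$ is continuously embedded into $L_K^{q_1}+L_K^{q_2}$. (ii) If $\lim_{R\to0^+}\mathcal{S}_0(q_1,R)=\lim_{R\to+\infty}\mathcal{S}_\infty(q_2,R)=0$, then $X$ is compactly embedded into $L_K^{q_1}+L_K^{q_2}$; that is, the embedding is continuous and every bounded sequence of $X$ has a subsequence that converges in $L_K^{q_1}+L_K^{q_2}$. -/

import Mathlib

open MeasureTheory Filter Topology Set
open scoped ENNReal ContDiff

namespace RadialEmbedding

/-! ### Hypotheses on the potentials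

The potentials are functions on the half line `(0, ∞)`; they are represented by functions `ℝ → ℝ`
whose values outside `(0, ∞)` play no role. -/

/-- Hypothesis (A). The quotients are nonnegative on `(0, ∞)`, so the lower and upper limits
are taken in `[0, ∞]`. -/
def HypA (N : ℕ) (p : ℝ) (A : ℝ → ℝ) : Prop :=
  ContinuousOn A (Ioi 0) ∧ (∀ r, 0 < r → 0 < A r) ∧
  ∃ a₀ ai c₀ ci : ℝ,
    (p - N < a₀ ∧ a₀ ≤ p) ∧ (p - N < ai ∧ ai ≤ p) ∧ 0 < c₀ ∧ 0 < ci ∧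
    ENNReal.ofReal c₀ ≤ liminf (fun r : ℝ => ENNReal.ofReal (A r / r ^ a₀)) (𝓝[>] 0) ∧
    limsup (fun r : ℝ => ENNReal.ofReal (A r / r ^ a₀)) (𝓝[>] 0) < ⊤ ∧
    ENNReal.ofReal ci ≤ liminf (fun r : ℝ => ENNReal.ofReal (A r / r ^ ai)) atTop ∧
    limsup (fun r : ℝ => ENNReal.ofReal (A r / r ^ ai)) atTop < ⊤

/-- Hypothesis (V): `V : (0, ∞) → [0, ∞)` is (Lebesgue) measurable and locally integrable. -/
def HypV (V : ℝ → ℝ) : Prop :=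
  AEMeasurable V (volume.restrict (Ioi 0)) ∧ (∀ r, 0 < r → 0 ≤ V r) ∧
  LocallyIntegrableOn V (Ioi 0) volume

/-- Hypothesis (K): `K : (0, ∞) → (0, ∞)` is (Lebesgue) measurable and belongs to
`L^s_loc((0, ∞))` for some real `s > 1`. -/
def HypK (K : ℝ → ℝ) : Prop :=
  AEMeasurable K (volume.restrict (Ioi 0)) ∧ (∀ r, 0 < r → 0 < K r) ∧
  ∃ s : ℝ, 1 < s ∧
    ∀ C : Set ℝ, IsCompact C → C ⊆ Ioi 0 → MemLp K (ENNReal.ofReal s) (volume.restrict C)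

/-! ### Function spaces -/

/-- The measure `w(|x|) dx` on `ℝ^N`. -/
noncomputable def radialMeasure (N : ℕ) (w : ℝ → ℝ) : Measure (EuclideanSpace ℝ (Fin N)) :=
  volume.withDensity (fun x => ENNReal.ofReal (w ‖x‖))

/-- The space `S_A` of radial `φ ∈ C_c^∞(ℝ^N)` with `∫ A(|x|) |∇φ|^p dx < ∞`. -/
def SA (N : ℕ) (p : ℝ) (A : ℝ → ℝ) : Set (EuclideanSpace ℝ (Fin N) → ℝ) :=
  {φ | ContDiff ℝ ∞ φ ∧ HasCompactSupport φ ∧ (∀ x y, ‖x‖ = ‖y‖ → φ x = φ y) ∧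
    eLpNorm (gradient φ) (ENNReal.ofReal p) (radialMeasure N A) < ⊤}

/-- `G` is the weak gradient of `u` in the open set `ℝ^N \ {0}`. -/
def IsWeakGradient {N : ℕ} (u : EuclideanSpace ℝ (Fin N) → ℝ)
    (G : EuclideanSpace ℝ (Fin N) → EuclideanSpace ℝ (Fin N)) : Prop :=
  LocallyIntegrableOn u {0}ᶜ volume ∧ LocallyIntegrableOn G {0}ᶜ volume ∧
  ∀ φ : EuclideanSpace ℝ (Fin N) → ℝ, ContDiff ℝ ∞ φ → HasCompactSupport φ → tsupport φ ⊆ {0}ᶜ →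
    ∀ i : Fin N,
      ∫ x, u x * fderiv ℝ φ x (EuclideanSpace.single i 1) = - ∫ x, G x i * φ x

open Classical in
/-- The weak gradient in `ℝ^N \ {0}` (unique up to null sets when it exists; `0` otherwise). -/
noncomputable def weakGradient {N : ℕ} (u : EuclideanSpace ℝ (Fin N) → ℝ) :
    EuclideanSpace ℝ (Fin N) → EuclideanSpace ℝ (Fin N) :=
  if h : ∃ G, IsWeakGradient u G then h.choose else 0

/-- The space `D_A`: the completion of `S_A` with respect to
`‖φ‖_A = (∫ A(|x|) |∇φ|^p dx)^(1/p)`, realised (up to equality almost everywhere) as a space of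
functions: the almost everywhere limits of the `‖·‖_A`-Cauchy sequences of `S_A`. -/
def DA (N : ℕ) (p : ℝ) (A : ℝ → ℝ) : Set (EuclideanSpace ℝ (Fin N) → ℝ) :=
  {u | ∃ φ : ℕ → EuclideanSpace ℝ (Fin N) → ℝ,
    (∀ n, φ n ∈ SA N p A) ∧
    (∀ ε : ℝ, 0 < ε → ∃ n₀, ∀ m ≥ n₀, ∀ n ≥ n₀,
      eLpNorm (gradient (φ m - φ n)) (ENNReal.ofReal p) (radialMeasure N A) ≤ ENNReal.ofReal ε) ∧
    ∀ᵐ x, Tendsto (fun n => φ n x) atTop (𝓝 (u x))}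

/-- The norm `‖u‖_A = (∫ A(|x|) |∇u|^p dx)^(1/p)`. -/
noncomputable def normA (N : ℕ) (p : ℝ) (A : ℝ → ℝ) (u : EuclideanSpace ℝ (Fin N) → ℝ) : ℝ≥0∞ :=
  eLpNorm (weakGradient u) (ENNReal.ofReal p) (radialMeasure N A)

/-- The space `X = D_A ∩ L^p(ℝ^N, V(|x|) dx)`. -/
def X (N : ℕ) (p : ℝ) (A V : ℝ → ℝ) : Set (EuclideanSpace ℝ (Fin N) → ℝ) :=
  {u | u ∈ DA N p A ∧ MemLp u (ENNReal.ofReal p) (radialMeasure N V)}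

/-- The norm `‖u‖ = (‖u‖_A^p + ‖u‖_{L^p(V)}^p)^(1/p)` of `X`. -/
noncomputable def normX (N : ℕ) (p : ℝ) (A V : ℝ → ℝ) (u : EuclideanSpace ℝ (Fin N) → ℝ) : ℝ≥0∞ :=
  (normA N p A u ^ p + eLpNorm u (ENNReal.ofReal p) (radialMeasure N V) ^ p) ^ (1 / p)

/-- `S_0(q, R)`, the supremum of `∫_{B_R} K(|x|) |u|^q dx` over the unit sphere of `X`. -/
noncomputable def S₀ (N : ℕ) (p : ℝ) (A V K : ℝ → ℝ) (q R : ℝ) : ℝ≥0∞ :=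
  ⨆ u ∈ {u | u ∈ X N p A V ∧ normX N p A V u = 1},
    ∫⁻ x in Metric.ball 0 R, ‖u x‖ₑ ^ q ∂(radialMeasure N K)

/-- `S_∞(q, R)`, the supremum of `∫_{ℝ^N \ B_R} K(|x|) |u|^q dx` over the unit sphere of `X`. -/
noncomputable def Sinf (N : ℕ) (p : ℝ) (A V K : ℝ → ℝ) (q R : ℝ) : ℝ≥0∞ :=
  ⨆ u ∈ {u | u ∈ X N p A V ∧ normX N p A V u = 1},
    ∫⁻ x in (Metric.ball 0 R)ᶜ, ‖u x‖ₑ ^ q ∂(radialMeasure N K)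

/-- `u = u₁ + u₂` (almost everywhere) with `u₁ ∈ L_K^{q₁}(ℝ^N)` and `u₂ ∈ L_K^{q₂}(ℝ^N)`. -/
def IsDecomposition (N : ℕ) (K : ℝ → ℝ) (q₁ q₂ : ℝ) (u u₁ u₂ : EuclideanSpace ℝ (Fin N) → ℝ) :
    Prop :=
  MemLp u₁ (ENNReal.ofReal q₁) (radialMeasure N K) ∧
  MemLp u₂ (ENNReal.ofReal q₂) (radialMeasure N K) ∧
  u =ᵐ[radialMeasure N K] u₁ + u₂

/-- The sum space `L_K^{q₁}(ℝ^N) + L_K^{q₂}(ℝ^N)`. -/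
def sumSpace (N : ℕ) (K : ℝ → ℝ) (q₁ q₂ : ℝ) : Set (EuclideanSpace ℝ (Fin N) → ℝ) :=
  {u | ∃ u₁ u₂, IsDecomposition N K q₁ q₂ u u₁ u₂}

/-- The norm of the sum space: the infimum of
`max (‖u₁‖_{L_K^{q₁}}) (‖u₂‖_{L_K^{q₂}})` over all decompositions `u = u₁ + u₂`. -/
noncomputable def sumNorm (N : ℕ) (K : ℝ → ℝ) (q₁ q₂ : ℝ) (u : EuclideanSpace ℝ (Fin N) → ℝ) :
    ℝ≥0∞ :=
  ⨅ (u₁ : EuclideanSpace ℝ (Fin N) → ℝ) (u₂ : EuclideanSpace ℝ (Fin N) → ℝ)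
    (_ : IsDecomposition N K q₁ q₂ u u₁ u₂),
    max (eLpNorm u₁ (ENNReal.ofReal q₁) (radialMeasure N K))
      (eLpNorm u₂ (ENNReal.ofReal q₂) (radialMeasure N K))

/-! ### Embeddings of function spaces -/

/-- The function space `Y` with norm `nY` is continuously embedded into `Z` with norm `nZ`. -/
def ContinuouslyEmbedded {E : Type*} (Y : Set (E → ℝ)) (nY : (E → ℝ) → ℝ≥0∞)
    (Z : Set (E → ℝ)) (nZ : (E → ℝ) → ℝ≥0∞) : Prop :=
  Y ⊆ Z ∧ ∃ C : ℝ, 0 < C ∧ ∀ u ∈ Y, nZ u ≤ ENNReal.ofReal C * nY u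

/-- The function space `Y` with norm `nY` is compactly embedded into `Z` with norm `nZ`: the
embedding is continuous, and every bounded sequence of `Y` has a subsequence that converges
in `Z`. -/
def CompactlyEmbedded {E : Type*} (Y : Set (E → ℝ)) (nY : (E → ℝ) → ℝ≥0∞)
    (Z : Set (E → ℝ)) (nZ : (E → ℝ) → ℝ≥0∞) : Prop :=
  ContinuouslyEmbedded Y nY Z nZ ∧
  ∀ u : ℕ → E → ℝ, (∀ n, u n ∈ Y) → (∃ C : ℝ, ∀ n, nY (u n) ≤ ENNReal.ofReal C) →
    ∃ k : ℕ → ℕ, StrictMono k ∧ ∃ v ∈ Z, Tendsto (fun n => nZ (u (k n) - v)) atTop (𝓝 0)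

end RadialEmbedding

namespace RadialEmbedding

/-! ### Polar coordinates -/

/-! Everything rests on a radial estimate. A radial test function is a function of `t = |x|`, so its
oscillation between two radii is at most the integral of its radial derivative. Hölder's inequality
with the weight `t ^ (N - 1) * A t` bounds this by `oscConst` of the interval of radii times the
weighted norm of the gradient (`enorm_sub_le_oscConst`). Since `a_∞ > p - N`, the constant is finite
even for `[r, ∞)`, which gives a pointwise bound away from the origin (`enorm_le_oscConst`).

Both estimates survive almost everywhere limits and hence hold on a set of full measure for every
element of `D_A` (`DA.exists_radialBoundsOn`). There the norm is the one given by the weak gradient,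
which is identified with the `L^p` limit of the gradients of the approximating test functions.

On an annulus a bounded set of `X` is therefore uniformly bounded, and `K(|x|) dx` has finite mass
there. For (i), cut at radius `max R₁ R₂`: by homogeneity `S₀` controls the inner ball and `Sinf`
the exterior, and the annulus left over is harmless.

For (ii), the oscillation estimate is an equicontinuity in the radius. As in Arzelà–Ascoli it yields
a subsequence converging almost everywhere. Dominated convergence gives convergence on annuli, while
the small values of `S₀` and `Sinf` and Fatou's lemma make the two tails uniformly small. No weak
compactness of `X` is involved. -/

theorem lintegral_fun_norm {E : Type*} [NormedAddCommGroup E] [NormedSpace ℝ E] [Nontrivial E]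
    [MeasurableSpace E] [BorelSpace E] [FiniteDimensional ℝ E] (μ : Measure E)
    [μ.IsAddHaarMeasure] {f : ℝ → ℝ≥0∞} (hf : Measurable f) :
    ∫⁻ x, f ‖x‖ ∂μ = μ.toSphere univ *
      ∫⁻ r in Ioi (0 : ℝ), ENNReal.ofReal (r ^ (Module.finrank ℝ E - 1)) * f r := by
  calc
    ∫⁻ x, f ‖x‖ ∂μ = ∫⁻ x : ({0}ᶜ : Set E), f ‖x.1‖ ∂(μ.comap (↑)) := by
      rw [lintegral_subtype_comap (measurableSet_singleton _).compl fun x => f ‖x‖,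
        restrict_compl_singleton]
    _ = ∫⁻ x, f x.2 ∂μ.toSphere.prod (.volumeIoiPow (Module.finrank ℝ E - 1)) := by
      simpa using μ.measurePreserving_homeomorphUnitSphereProd.lintegral_comp_emb
        (Homeomorph.measurableEmbedding _) (f ∘ Subtype.val ∘ Prod.snd)
    _ = μ.toSphere univ *
        ∫⁻ x : Ioi (0 : ℝ), f x ∂.volumeIoiPow (Module.finrank ℝ E - 1) := by
      rw [lintegral_prod _ (by fun_prop)]
      simp [mul_comm]
    _ = _ := by
      rw [Measure.volumeIoiPow, lintegral_withDensity_eq_lintegral_mul _ (by fun_prop)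
        (by fun_prop)]
      congr 1
      exact lintegral_subtype_comap measurableSet_Ioi
        fun r => ENNReal.ofReal (r ^ (Module.finrank ℝ E - 1)) * f r

/-- The total mass of the unit sphere of `ℝ^N`. -/
noncomputable def sphereMass (N : ℕ) : ℝ≥0∞ :=
  (volume : Measure (EuclideanSpace ℝ (Fin N))).toSphere univ

theorem sphereMass_ne_zero {N : ℕ} (hN : 3 ≤ N) : sphereMass N ≠ 0 := by
  have : Nonempty (Fin N) := ⟨⟨0, by omega⟩⟩
  exact Measure.measure_univ_ne_zero.2 (Measure.toSphere_ne_zero _)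

theorem sphereMass_ne_top (N : ℕ) : sphereMass N ≠ ⊤ := measure_ne_top _ _

theorem lintegral_norm_eq {N : ℕ} (hN : 3 ≤ N) {f : ℝ → ℝ≥0∞} (hf : Measurable f) :
    ∫⁻ x : EuclideanSpace ℝ (Fin N), f ‖x‖ = sphereMass N *
      ∫⁻ r in Ioi (0 : ℝ), ENNReal.ofReal (r ^ (N - 1)) * f r := by
  have : Nonempty (Fin N) := ⟨⟨0, by omega⟩⟩
  have h := lintegral_fun_norm (volume : Measure (EuclideanSpace ℝ (Fin N))) hf
  rwa [finrank_euclideanSpace_fin] at h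

/-! ### Radial functions -/

/-- The one-dimensional weight `t ^ (N - 1) * A t`. -/
noncomputable def radialWeight (N : ℕ) (A : ℝ → ℝ) (t : ℝ) : ℝ≥0∞ :=
  ENNReal.ofReal (t ^ (N - 1) * A t)

/-- The constant in Hölder's inequality for the oscillation of a radial function over the radii
in `I`. -/
noncomputable def oscConst (N : ℕ) (p : ℝ) (A : ℝ → ℝ) (I : Set ℝ) : ℝ≥0∞ :=
  (sphereMass N)⁻¹ ^ (1 / p) *
    (∫⁻ t in I, radialWeight N A t ^ (-(1 / (p - 1)))) ^ (1 - 1 / p)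

theorem oscConst_mono {N : ℕ} {p : ℝ} (hp : 1 < p) {A : ℝ → ℝ} {I J : Set ℝ} (h : I ⊆ J) :
    oscConst N p A I ≤ oscConst N p A J := by
  unfold oscConst
  have : 0 ≤ 1 - 1 / p := by
    rw [sub_nonneg, div_le_one (by linarith)]; exact hp.le
  gcongr

/-- The smooth, compactly supported radial functions on `ℝ^N`. -/
def IsRadialTest {N : ℕ} (φ : EuclideanSpace ℝ (Fin N) → ℝ) : Prop :=
  ContDiff ℝ ∞ φ ∧ HasCompactSupport φ ∧ ∀ x y, ‖x‖ = ‖y‖ → φ x = φ y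

/-- By symmetry the ray through `e` may be replaced by the ray through `x`. The radial derivative is
then the inner product of the gradient with a unit vector, and Cauchy–Schwarz applies. -/
theorem enorm_deriv_le_enorm_gradient {N : ℕ} {φ : EuclideanSpace ℝ (Fin N) → ℝ}
    (hφ : IsRadialTest φ) {e : EuclideanSpace ℝ (Fin N)} (he : ‖e‖ = 1)
    (x : EuclideanSpace ℝ (Fin N)) (hx : x ≠ 0) :
    ‖deriv (fun t : ℝ => φ (t • e)) ‖x‖‖ₑ ≤ ‖gradient φ x‖ₑ := by
  have hd : Differentiable ℝ φ := hφ.1.differentiable (by simp)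
  have hx' : ‖x‖ ≠ 0 := norm_ne_zero_iff.2 hx
  set y := (‖x‖⁻¹ : ℝ) • x with hy
  have hyn : ‖y‖ = 1 := by rw [hy, norm_smul]; simp [hx']
  have h1 : (fun t : ℝ => φ (t • e)) = fun t : ℝ => φ (t • y) := by
    ext t
    exact hφ.2.2 _ _ (by simp [norm_smul, he, hyn])
  have h2 : ‖x‖ • y = x := by simp [hy, smul_smul, hx']
  have h3 : HasDerivAt (fun t : ℝ => φ (t • y)) (fderiv ℝ φ x y) ‖x‖ := by
    have := (hd (‖x‖ • y)).hasFDerivAt.comp_hasDerivAt ‖x‖ ((hasDerivAt_id ‖x‖).smul_const y)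
    simpa only [h2, one_smul, id, Function.comp_def] using this
  rw [h1, h3.deriv, enorm_le_iff_norm_le, ← inner_gradient_left]
  simpa [hyn] using norm_inner_le_norm (𝕜 := ℝ) (gradient φ x) y

theorem measurable_indicator_of_continuousOn {A : ℝ → ℝ} (hA : ContinuousOn A (Ioi 0)) :
    Measurable ((Ioi (0 : ℝ)).indicator A) := by
  classical
  rw [← piecewise_eq_indicator]
  exact hA.measurable_piecewise continuousOn_const measurableSet_Ioi

theorem aemeasurable_radial_of_continuousOn {N : ℕ} (hN : 3 ≤ N) {A : ℝ → ℝ}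
    (hA : ContinuousOn A (Ioi 0)) :
    AEMeasurable (fun x : EuclideanSpace ℝ (Fin N) => ENNReal.ofReal (A ‖x‖)) := by
  have : Nonempty (Fin N) := ⟨⟨0, by omega⟩⟩
  refine ⟨fun x => ENNReal.ofReal ((Ioi (0 : ℝ)).indicator A ‖x‖),
    ((measurable_indicator_of_continuousOn hA).comp measurable_norm).ennreal_ofReal, ?_⟩
  filter_upwards [compl_mem_ae_iff.2 (measure_singleton (0 : EuclideanSpace ℝ (Fin N)))] with x hx
  have : 0 < ‖x‖ := norm_pos_iff.2 hx
  simp [this]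

/-- The radial derivative is controlled by the gradient in the weighted norm. -/
theorem lintegral_radialWeight_deriv_le {N : ℕ} (hN : 3 ≤ N) {p : ℝ} (hp : 1 < p) {A : ℝ → ℝ}
    (hA : ContinuousOn A (Ioi 0)) {φ : EuclideanSpace ℝ (Fin N) → ℝ} (hφ : IsRadialTest φ)
    {e : EuclideanSpace ℝ (Fin N)} (he : ‖e‖ = 1) :
    ∫⁻ t in Ioi (0 : ℝ), radialWeight N A t * ‖deriv (fun t : ℝ => φ (t • e)) t‖ₑ ^ p ≤
      (sphereMass N)⁻¹ * eLpNorm (gradient φ) (ENNReal.ofReal p) (radialMeasure N A) ^ p := by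
  have : Nonempty (Fin N) := ⟨⟨0, by omega⟩⟩
  have hp0 : 0 < p := by linarith
  set f := fun t : ℝ => φ (t • e) with hf
  have hfm : Measurable (deriv f) := measurable_deriv f
  -- `A` is arbitrary outside `(0, ∞)`; cutting it off there gives the measurable function that
  -- polar coordinates require.
  set B := (Ioi (0 : ℝ)).indicator A
  have hB : Measurable B := measurable_indicator_of_continuousOn hA
  rw [eLpNorm_eq_lintegral_rpow_enorm_toReal (by simpa using hp0) (by simp),
    ENNReal.toReal_ofReal hp0.le, ← ENNReal.rpow_mul, one_div_mul_cancel hp0.ne', ENNReal.rpow_one,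
    radialMeasure, ← ENNReal.mul_le_iff_le_inv (sphereMass_ne_zero hN) (sphereMass_ne_top N)]
  have h1 := lintegral_norm_eq hN
    (f := fun t => ENNReal.ofReal (B t) * ‖deriv f t‖ₑ ^ p) (by fun_prop)
  calc _ = sphereMass N * ∫⁻ r in Ioi (0 : ℝ), ENNReal.ofReal (r ^ (N - 1)) *
          (ENNReal.ofReal (B r) * ‖deriv f r‖ₑ ^ p) := by
        congr 1
        refine setLIntegral_congr_fun measurableSet_Ioi fun r hr => ?_
        have hr' : (0 : ℝ) < r := hr
        simp only [radialWeight, B, indicator_of_mem hr, ← mul_assoc]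
        rw [ENNReal.ofReal_mul (by positivity)]
    _ = _ := h1.symm
    _ ≤ ∫⁻ x : EuclideanSpace ℝ (Fin N), ENNReal.ofReal (A ‖x‖) * ‖gradient φ x‖ₑ ^ p := by
        refine lintegral_mono_ae ?_
        filter_upwards [compl_mem_ae_iff.2
          (measure_singleton (0 : EuclideanSpace ℝ (Fin N)))] with x hx
        have hx' : 0 < ‖x‖ := norm_pos_iff.2 hx
        simp only [B, indicator_of_mem (show ‖x‖ ∈ Ioi (0 : ℝ) from hx')]
        gcongr
        exact enorm_deriv_le_enorm_gradient hφ he x hx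
    _ = _ := (lintegral_withDensity_eq_lintegral_mul_non_measurable₀ _
        (aemeasurable_radial_of_continuousOn hN hA) (by simp) _).symm

theorem enorm_sub_le_oscConst {N : ℕ} (hN : 3 ≤ N) {p : ℝ} (hp : 1 < p) {A : ℝ → ℝ}
    (hA : ContinuousOn A (Ioi 0)) (hA0 : ∀ r, 0 < r → 0 < A r)
    {φ : EuclideanSpace ℝ (Fin N) → ℝ} (hφ : IsRadialTest φ) {x y : EuclideanSpace ℝ (Fin N)}
    (hx : x ≠ 0) (hxy : ‖x‖ ≤ ‖y‖) :
    ‖φ y - φ x‖ₑ ≤ oscConst N p A (Icc ‖x‖ ‖y‖) *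
      eLpNorm (gradient φ) (ENNReal.ofReal p) (radialMeasure N A) := by
  have hp0 : 0 < p := by linarith
  have hx' : 0 < ‖x‖ := norm_pos_iff.2 hx
  obtain ⟨e, he⟩ : ∃ e : EuclideanSpace ℝ (Fin N), ‖e‖ = 1 :=
    ⟨(‖x‖⁻¹ : ℝ) • x, by rw [norm_smul]; simp [hx'.ne']⟩
  set f := fun t : ℝ => φ (t • e) with hf
  have hfx : φ x = f ‖x‖ := hφ.2.2 _ _ (by simp [norm_smul, he])
  have hfy : φ y = f ‖y‖ := hφ.2.2 _ _ (by simp [norm_smul, he])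
  have hfc : ContDiff ℝ 1 f :=
    (hφ.1.of_le (by exact_mod_cast le_top)).comp (contDiff_id.smul contDiff_const)
  have hI : Icc ‖x‖ ‖y‖ ⊆ Ioi 0 := fun t ht => hx'.trans_le ht.1
  set W := fun t => radialWeight N A t with hW
  have hWm : AEMeasurable W (volume.restrict (Icc ‖x‖ ‖y‖)) := by
    refine ENNReal.measurable_ofReal.comp_aemeasurable
      (ContinuousOn.aemeasurable ?_ measurableSet_Icc)
    exact (continuousOn_id.pow _).mul (hA.mono hI)
  have hW0 : ∀ t, 0 < t → W t ≠ 0 := fun t ht => by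
    have := hA0 t ht
    simp only [hW, radialWeight, ne_eq, ENNReal.ofReal_eq_zero, not_le]
    positivity
  have hWt : ∀ t, W t ≠ ⊤ := fun t => ENNReal.ofReal_ne_top
  have hpq : p.HolderConjugate (p / (p - 1)) := Real.HolderConjugate.conjExponent hp
  have hpm : 0 < p - 1 := by linarith
  rw [hfx, hfy]
  calc _ ≤ ∫⁻ t in Icc ‖x‖ ‖y‖, ‖deriv f t‖ₑ :=
        enorm_sub_le_lintegral_deriv_of_contDiffOn_Icc hfc.contDiffOn hxy
    -- Splitting `1 = W ^ (1/p) * W ^ (-1/p)` is legitimate because `0 < W < ∞` on the interval;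
    -- Hölder's inequality is applied to the two factors.
    _ = ∫⁻ t in Icc ‖x‖ ‖y‖,
        ((fun t => W t ^ (1 / p) * ‖deriv f t‖ₑ) * fun t => W t ^ (-(1 / p))) t := by
        refine setLIntegral_congr_fun measurableSet_Icc fun t ht => ?_
        simp only [Pi.mul_apply]
        rw [mul_right_comm, ← ENNReal.rpow_add _ _ (hW0 t (hI ht)) (hWt t), add_neg_cancel,
          ENNReal.rpow_zero, one_mul]
    _ ≤ (∫⁻ t in Icc ‖x‖ ‖y‖, (W t ^ (1 / p) * ‖deriv f t‖ₑ) ^ p) ^ (1 / p) *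
        (∫⁻ t in Icc ‖x‖ ‖y‖, (W t ^ (-(1 / p))) ^ (p / (p - 1))) ^ (1 / (p / (p - 1))) :=
        ENNReal.lintegral_mul_le_Lp_mul_Lq _ hpq
          ((hWm.pow_const _).mul (measurable_deriv f).enorm.aemeasurable) (hWm.pow_const _)
    _ = (∫⁻ t in Icc ‖x‖ ‖y‖, W t * ‖deriv f t‖ₑ ^ p) ^ (1 / p) *
        (∫⁻ t in Icc ‖x‖ ‖y‖, W t ^ (-(1 / (p - 1)))) ^ (1 - 1 / p) := by
        congr 3
        · ext t
          rw [ENNReal.mul_rpow_of_nonneg _ _ hp0.le, ← ENNReal.rpow_mul,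
            one_div_mul_cancel hp0.ne', ENNReal.rpow_one]
        · ext t
          rw [← ENNReal.rpow_mul]
          congr 1
          field_simp
        · field_simp
    _ ≤ ((sphereMass N)⁻¹ * eLpNorm (gradient φ) (ENNReal.ofReal p) (radialMeasure N A) ^ p)
          ^ (1 / p) * (∫⁻ t in Icc ‖x‖ ‖y‖, W t ^ (-(1 / (p - 1)))) ^ (1 - 1 / p) := by
        gcongr
        exact (lintegral_mono_set hI).trans (lintegral_radialWeight_deriv_le hN hp hA hφ he)
    _ = _ := by
        rw [ENNReal.mul_rpow_of_nonneg _ _ (by positivity), ← ENNReal.rpow_mul,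
          mul_one_div_cancel hp0.ne', ENNReal.rpow_one, oscConst]
        ring

theorem enorm_le_oscConst {N : ℕ} (hN : 3 ≤ N) {p : ℝ} (hp : 1 < p) {A : ℝ → ℝ}
    (hA : ContinuousOn A (Ioi 0)) (hA0 : ∀ r, 0 < r → 0 < A r)
    {φ : EuclideanSpace ℝ (Fin N) → ℝ} (hφ : IsRadialTest φ) {x : EuclideanSpace ℝ (Fin N)}
    (hx : x ≠ 0) :
    ‖φ x‖ₑ ≤ oscConst N p A (Ici ‖x‖) *
      eLpNorm (gradient φ) (ENNReal.ofReal p) (radialMeasure N A) := by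
  have hx' : 0 < ‖x‖ := norm_pos_iff.2 hx
  obtain ⟨R, hR⟩ := hφ.2.1.isCompact.isBounded.subset_closedBall (0 : EuclideanSpace ℝ (Fin N))
  -- The dilated point `s • x` lies beyond the support, where `φ` vanishes, and is at least as far
  -- out as `x`.
  set s := max 1 ((|R| + 1) / ‖x‖)
  have hs : 0 < s := lt_max_of_lt_left one_pos
  have hsn : ‖s • x‖ = s * ‖x‖ := by rw [norm_smul, Real.norm_of_nonneg hs.le]
  have hy : φ (s • x) = 0 := by
    by_contra h
    have h1 := hR (subset_tsupport _ h)
    rw [mem_closedBall_zero_iff, hsn] at h1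
    have h2 : (|R| + 1) / ‖x‖ ≤ s := le_max_right _ _
    rw [div_le_iff₀ hx'] at h2
    linarith [le_abs_self R]
  have hle : ‖x‖ ≤ ‖s • x‖ := by
    rw [hsn]; exact le_mul_of_one_le_left hx'.le (le_max_left _ _)
  have := enorm_sub_le_oscConst hN hp hA hA0 hφ hx hle
  rw [hy, zero_sub, enorm_neg] at this
  refine this.trans ?_
  gcongr
  exact oscConst_mono hp Icc_subset_Ici_self

/-! ### Finiteness of the constants -/

/-- Near infinity the weight is at least a multiple of `t ^ (N - 1 + a)`. Its power `-1/(p-1)` is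
integrable there because `(N - 1 + a)/(p - 1) > 1`, which is exactly `a > p - N`. On the remaining
compact interval the integrand is continuous. -/
theorem lintegral_radialWeight_lt_top {N : ℕ} (hN : 3 ≤ N) {p : ℝ} (hp : 1 < p) {A : ℝ → ℝ}
    (hA : HypA N p A) {r : ℝ} (hr : 0 < r) :
    ∫⁻ t in Ici r, radialWeight N A t ^ (-(1 / (p - 1))) < ⊤ := by
  obtain ⟨hAc, hA0, a₀, a, c₀, c, -, ⟨ha, -⟩, -, hc, -, -, hlim, -⟩ := hA
  have hpm : 0 < p - 1 := by linarith
  -- Halving `c` gives the strict inequality needed to pass from the lower limit to an eventual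
  -- bound.
  have hev : ∀ᶠ t in atTop, ENNReal.ofReal (c / 2) < ENNReal.ofReal (A t / t ^ a) :=
    eventually_lt_of_lt_liminf (lt_of_lt_of_le
      ((ENNReal.ofReal_lt_ofReal_iff hc).2 (by linarith)) hlim)
  obtain ⟨R, hR⟩ := eventually_atTop.1 (hev.and (eventually_ge_atTop r))
  have hRr : r ≤ R := (hR R le_rfl).2
  have hR0 : 0 < R := hr.trans_le hRr
  set b : ℝ := (N - 1 + a) * (-(1 / (p - 1))) with hb
  have hb1 : b < -1 := by
    rw [hb, mul_neg, neg_lt_neg_iff, mul_one_div, lt_div_iff₀ hpm]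
    linarith
  have hneg : -(1 / (p - 1)) ≤ 0 := by
    rw [neg_nonpos]; positivity
  have hconv : ∀ t, 0 < t → radialWeight N A t ^ (-(1 / (p - 1))) =
      ENNReal.ofReal ((t ^ (N - 1) * A t) ^ (-(1 / (p - 1)))) := fun t ht => by
    have := hA0 t ht
    rw [radialWeight, ENNReal.ofReal_rpow_of_pos (by positivity)]
  have hcpt : ∫⁻ t in Icc r R, radialWeight N A t ^ (-(1 / (p - 1))) < ⊤ := by
    have hcont : ContinuousOn (fun t => (t ^ (N - 1) * A t) ^ (-(1 / (p - 1)))) (Icc r R) := by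
      refine ContinuousOn.rpow_const ?_ fun t ht => ?_
      · exact (continuousOn_id.pow _).mul (hAc.mono fun t ht => hr.trans_le ht.1)
      · have ht0 : 0 < t := hr.trans_le ht.1
        have := hA0 t ht0
        left; positivity
    rw [setLIntegral_congr_fun measurableSet_Icc fun t ht => hconv t (hr.trans_le ht.1)]
    exact hcont.integrableOn_Icc.setLIntegral_lt_top
  have htail : ∫⁻ t in Ioi R, radialWeight N A t ^ (-(1 / (p - 1))) < ⊤ := by
    have hint : IntegrableOn (fun t : ℝ => (c / 2) ^ (-(1 / (p - 1))) * t ^ b) (Ioi R) :=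
      (integrableOn_Ioi_rpow_of_lt hb1 hR0).const_mul _
    refine lt_of_le_of_lt (setLIntegral_mono_ae' measurableSet_Ioi (.of_forall fun t ht => ?_))
      hint.setLIntegral_lt_top
    have ht0 : 0 < t := hR0.trans ht
    have hAt := hA0 t ht0
    rw [hconv t ht0]
    refine ENNReal.ofReal_le_ofReal ?_
    have h1 : c / 2 * t ^ a ≤ A t := by
      have := (ENNReal.ofReal_lt_ofReal_iff (by positivity)).1 (hR t ht.le).1
      rw [lt_div_iff₀ (by positivity)] at this
      exact this.le
    have h2 : c / 2 * t ^ (N - 1 + a : ℝ) ≤ t ^ (N - 1) * A t := by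
      have : t ^ (N - 1 + a : ℝ) = t ^ (N - 1) * t ^ a := by
        rw [Real.rpow_add ht0, ← Real.rpow_natCast, Nat.cast_sub (by omega), Nat.cast_one]
      rw [this]
      calc _ = t ^ (N - 1) * (c / 2 * t ^ a) := by ring
        _ ≤ _ := by gcongr
    calc _ ≤ (c / 2 * t ^ (N - 1 + a : ℝ)) ^ (-(1 / (p - 1))) :=
          Real.rpow_le_rpow_of_nonpos (by positivity) h2 hneg
      _ = _ := by
          rw [Real.mul_rpow (by positivity) (by positivity), ← Real.rpow_mul ht0.le]
  calc _ ≤ ∫⁻ t in Icc r R ∪ Ioi R, radialWeight N A t ^ (-(1 / (p - 1))) :=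
        lintegral_mono_set fun t ht => by
          rcases le_or_gt t R with h | h
          · exact Or.inl ⟨ht, h⟩
          · exact Or.inr h
    _ ≤ _ := lintegral_union_le _ _ _
    _ < ⊤ := ENNReal.add_lt_top.2 ⟨hcpt, htail⟩

theorem oscConst_Ici_lt_top {N : ℕ} (hN : 3 ≤ N) {p : ℝ} (hp : 1 < p) {A : ℝ → ℝ}
    (hA : HypA N p A) {r : ℝ} (hr : 0 < r) : oscConst N p A (Ici r) < ⊤ := by
  have hp0 : 0 < p := by linarith
  refine ENNReal.mul_lt_top ?_ ?_
  · exact ENNReal.rpow_lt_top_of_nonneg (by positivity) (by simpa using sphereMass_ne_zero hN)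
  · refine ENNReal.rpow_lt_top_of_nonneg ?_ (lintegral_radialWeight_lt_top hN hp hA hr).ne
    rw [sub_nonneg, div_le_one hp0]; exact hp.le

/-- Absolute continuity of the integral. This is the source of equicontinuity in the radius; the
one-sided limit suffices. -/
theorem tendsto_oscConst_Icc {N : ℕ} (hN : 3 ≤ N) {p : ℝ} (hp : 1 < p) {A : ℝ → ℝ}
    (hA : HypA N p A) {r : ℝ} (hr : 0 < r) :
    Tendsto (fun s => oscConst N p A (Icc r s)) (𝓝[>] r) (𝓝 0) := by
  have hp0 : 0 < p := by linarith
  have hexp : 0 < 1 - 1 / p := by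
    rw [sub_pos, div_lt_one hp0]; exact hp
  have h1 : Tendsto (fun s => ∫⁻ t in Icc r s, radialWeight N A t ^ (-(1 / (p - 1))))
      (𝓝[>] r) (𝓝 0) := by
    have hvol : Tendsto (fun s => (volume.restrict (Ici r)) (Icc r s)) (𝓝[>] r) (𝓝 0) := by
      have : ∀ s, (volume.restrict (Ici r)) (Icc r s) = ENNReal.ofReal (s - r) := fun s => by
        rw [Measure.restrict_apply measurableSet_Icc,
          inter_eq_self_of_subset_left Icc_subset_Ici_self, Real.volume_Icc]
      simp_rw [this]
      have h : Tendsto (fun s : ℝ => ENNReal.ofReal (s - r)) (𝓝 r) (𝓝 (ENNReal.ofReal (r - r))) :=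
        ENNReal.tendsto_ofReal ((continuous_id.sub continuous_const).tendsto r)
      rw [sub_self, ENNReal.ofReal_zero] at h
      exact h.mono_left nhdsWithin_le_nhds
    have := tendsto_setLIntegral_zero (lintegral_radialWeight_lt_top hN hp hA hr).ne hvol
    refine this.congr fun s => ?_
    rw [Measure.restrict_restrict measurableSet_Icc,
      inter_eq_self_of_subset_left Icc_subset_Ici_self]
  have h2 := (ENNReal.continuous_rpow_const (y := 1 - 1 / p)).tendsto 0 |>.comp h1
  rw [ENNReal.zero_rpow_of_pos hexp] at h2
  have h3 := ENNReal.Tendsto.const_mul (a := (sphereMass N)⁻¹ ^ (1 / p)) h2 (Or.inr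
    (ENNReal.rpow_lt_top_of_nonneg (by positivity) (by simpa using sphereMass_ne_zero hN)).ne)
  simpa [oscConst] using h3

/-! ### Weighted and unweighted norms away from the origin -/

theorem radialMeasure_absolutelyContinuous (N : ℕ) (w : ℝ → ℝ) :
    radialMeasure N w ≪ (volume : Measure (EuclideanSpace ℝ (Fin N))) :=
  withDensity_absolutelyContinuous _ _

/-- `A(|x|)` has a positive lower bound on a compact set that avoids the origin. -/
theorem exists_restrict_le_smul_radialMeasure {N : ℕ} {A : ℝ → ℝ}
    (hA : ContinuousOn A (Ioi 0)) (hA0 : ∀ r, 0 < r → 0 < A r)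
    {C : Set (EuclideanSpace ℝ (Fin N))} (hC : IsCompact C) (hC0 : C ⊆ {0}ᶜ) :
    ∃ c : ℝ≥0∞, c ≠ ⊤ ∧ volume.restrict C ≤ c • radialMeasure N A := by
  have hpos : ∀ x ∈ C, 0 < ‖x‖ := fun x hx => norm_pos_iff.2 (hC0 hx)
  obtain ⟨m, hm, hmC⟩ := hC.exists_forall_le' (f := fun x => A ‖x‖) (a := 0)
    (hA.comp continuous_norm.continuousOn hpos) fun x hx => hA0 _ (hpos x hx)
  have hm' : ENNReal.ofReal m ≠ 0 := by simpa using hm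
  refine ⟨(ENNReal.ofReal m)⁻¹, by simpa using hm, Measure.le_iff.2 fun s hs => ?_⟩
  rw [Measure.restrict_apply hs, Measure.smul_apply, smul_eq_mul, radialMeasure,
    withDensity_apply _ hs, ← ENNReal.mul_le_iff_le_inv hm' ENNReal.ofReal_ne_top]
  calc _ = ∫⁻ _ in s ∩ C, ENNReal.ofReal m := by rw [setLIntegral_const]
    _ ≤ ∫⁻ x in s ∩ C, ENNReal.ofReal (A ‖x‖) :=
      setLIntegral_mono_ae' (hs.inter hC.measurableSet)
        (.of_forall fun x hx => ENNReal.ofReal_le_ofReal (hmC x hx.2))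
    _ ≤ _ := lintegral_mono_set inter_subset_left

/-- The constant does not depend on `H`, so weighted `L^p` convergence of gradients implies `L^1`
convergence on compact sets away from the origin. -/
theorem exists_eLpNorm_one_restrict_le {N : ℕ} {p : ℝ} (hp : 1 < p) {A : ℝ → ℝ}
    (hA : ContinuousOn A (Ioi 0)) (hA0 : ∀ r, 0 < r → 0 < A r)
    {C : Set (EuclideanSpace ℝ (Fin N))} (hC : IsCompact C) (hC0 : C ⊆ {0}ᶜ) :
    ∃ c : ℝ≥0∞, c ≠ ⊤ ∧ ∀ H : EuclideanSpace ℝ (Fin N) → EuclideanSpace ℝ (Fin N),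
      MemLp H (ENNReal.ofReal p) (radialMeasure N A) →
      IntegrableOn H C ∧ eLpNorm H 1 (volume.restrict C) ≤
        c * eLpNorm H (ENNReal.ofReal p) (radialMeasure N A) := by
  obtain ⟨c, hc, hle⟩ := exists_restrict_le_smul_radialMeasure hA hA0 hC hC0
  have : IsFiniteMeasure (volume.restrict C) :=
    isFiniteMeasure_restrict.2 hC.measure_lt_top.ne
  have hp1 : (1 : ℝ≥0∞) ≤ ENNReal.ofReal p := by simpa using hp.le
  set a := volume.restrict C univ ^ (1 / (1 : ℝ≥0∞).toReal - 1 / (ENNReal.ofReal p).toReal) with ha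
  refine ⟨c ^ (1 / (ENNReal.ofReal p).toReal) * a,
    ENNReal.mul_ne_top ?_ ?_, fun H hH => ?_⟩
  · exact ENNReal.rpow_ne_top_of_nonneg (by positivity) hc
  · refine ENNReal.rpow_ne_top_of_nonneg ?_ (measure_ne_top _ _)
    rw [ENNReal.toReal_one, ENNReal.toReal_ofReal (by linarith), sub_nonneg,
      div_le_div_iff₀ (by linarith) one_pos]
    linarith
  · have hHC : MemLp H (ENNReal.ofReal p) (volume.restrict C) := hH.of_measure_le_smul hc hle
    refine ⟨hHC.integrable hp1, ?_⟩
    calc _ ≤ eLpNorm H (ENNReal.ofReal p) (volume.restrict C) * a :=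
          eLpNorm_le_eLpNorm_mul_rpow_measure_univ hp1 hHC.1
      _ ≤ (c ^ (1 / (ENNReal.ofReal p).toReal) *
            eLpNorm H (ENNReal.ofReal p) (radialMeasure N A)) * a := by
          gcongr
          refine (eLpNorm_mono_measure H hle).trans ?_
          rw [eLpNorm_smul_measure_of_ne_top ENNReal.ofReal_ne_top, smul_eq_mul]
          simp
      _ = _ := by ring

/-! ### Uniqueness of weak gradients -/

/-- The fundamental lemma of the calculus of variations, applied to each coordinate in the
complement of the origin, which is a null set. -/
theorem IsWeakGradient.ae_eq {N : ℕ} (hN : 3 ≤ N) {u : EuclideanSpace ℝ (Fin N) → ℝ}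
    {G G' : EuclideanSpace ℝ (Fin N) → EuclideanSpace ℝ (Fin N)}
    (h : IsWeakGradient u G) (h' : IsWeakGradient u G') : G =ᵐ[volume] G' := by
  have : Nonempty (Fin N) := ⟨⟨0, by omega⟩⟩
  have key : ∀ i : Fin N, ∀ᵐ x, x ∈ ({0}ᶜ : Set (EuclideanSpace ℝ (Fin N))) →
      G x i - G' x i = 0 := by
    intro i
    have hloc : ∀ {F : EuclideanSpace ℝ (Fin N) → EuclideanSpace ℝ (Fin N)},
        LocallyIntegrableOn F {0}ᶜ volume → LocallyIntegrableOn (fun x => F x i) {0}ᶜ volume :=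
      fun hF x hx => by
        obtain ⟨s, hs, hi⟩ := hF x hx
        exact ⟨s, hs, (EuclideanSpace.proj (𝕜 := ℝ) i).integrable_comp hi⟩
    refine isOpen_compl_singleton.ae_eq_zero_of_integral_contDiff_smul_eq_zero
      ((hloc h.2.1).sub (hloc h'.2.1)) fun g hg hgc hg0 => ?_
    have hint : ∀ {F : EuclideanSpace ℝ (Fin N) → EuclideanSpace ℝ (Fin N)},
        LocallyIntegrableOn F {0}ᶜ volume → Integrable fun x => F x i * g x := fun {F} hF => by
      have h1 := (hloc hF).integrableOn_compact_subset hg0 hgc.isCompact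
      have h2 : IntegrableOn (fun x => F x i * g x) (tsupport g) :=
        h1.mul_continuousOn hg.continuous.continuousOn hgc.isCompact
      exact (integrableOn_iff_integrable_of_support_subset
        ((Function.support_mul_subset_right _ _).trans (subset_tsupport _))).1 h2
    have e1 := h.2.2 g hg hgc hg0 i
    have e2 := h'.2.2 g hg hgc hg0 i
    have : ∫ x, g x • (G x i - G' x i) = ∫ x, (G x i * g x - G' x i * g x) := by
      congr 1; ext x; rw [smul_eq_mul]; ring
    rw [this, integral_sub (hint h.2.1) (hint h'.2.1)]
    linarith
  filter_upwards [ae_all_iff.2 key,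
    compl_mem_ae_iff.2 (measure_singleton (0 : EuclideanSpace ℝ (Fin N)))] with x hx hx0
  ext i
  exact sub_eq_zero.1 (hx i hx0)

/-- `weakGradient` is an arbitrary choice; this allows `normA` to be computed from any weak gradient
at hand. -/
theorem IsWeakGradient.normA_eq {N : ℕ} (hN : 3 ≤ N) {p : ℝ} {A : ℝ → ℝ}
    {u : EuclideanSpace ℝ (Fin N) → ℝ} {G : EuclideanSpace ℝ (Fin N) → EuclideanSpace ℝ (Fin N)}
    (h : IsWeakGradient u G) :
    normA N p A u = eLpNorm G (ENNReal.ofReal p) (radialMeasure N A) := by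
  have hex : ∃ G, IsWeakGradient u G := ⟨G, h⟩
  refine eLpNorm_congr_ae ((radialMeasure_absolutelyContinuous N A).ae_le ?_)
  rw [weakGradient, dif_pos hex]
  exact hex.choose_spec.ae_eq hN h

theorem IsWeakGradient.const_smul {N : ℕ} {u : EuclideanSpace ℝ (Fin N) → ℝ}
    {G : EuclideanSpace ℝ (Fin N) → EuclideanSpace ℝ (Fin N)} (h : IsWeakGradient u G) (c : ℝ) :
    IsWeakGradient (c • u) (c • G) := by
  refine ⟨h.1.smul c, h.2.1.smul c, fun φ h1 h2 h3 i => ?_⟩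
  have := h.2.2 φ h1 h2 h3 i
  simp only [Pi.smul_apply, smul_eq_mul, PiLp.smul_apply, mul_assoc]
  rw [integral_const_mul, integral_const_mul, this, mul_neg]

/-! ### Approximation of elements of `D_A` -/

theorem gradient_apply {N : ℕ} (φ : EuclideanSpace ℝ (Fin N) → ℝ) (x : EuclideanSpace ℝ (Fin N))
    (i : Fin N) : gradient φ x i = fderiv ℝ φ x (EuclideanSpace.single i 1) := by
  rw [← inner_gradient_left, EuclideanSpace.inner_single_right]
  simp

theorem continuous_gradient {N : ℕ} {φ : EuclideanSpace ℝ (Fin N) → ℝ} (hφ : ContDiff ℝ ∞ φ) :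
    Continuous (gradient φ) :=
  (InnerProductSpace.toDual ℝ (EuclideanSpace ℝ (Fin N))).symm.continuous.comp
    (hφ.continuous_fderiv (by simp))

theorem gradient_sub {N : ℕ} {φ ψ : EuclideanSpace ℝ (Fin N) → ℝ} (hφ : Differentiable ℝ φ)
    (hψ : Differentiable ℝ ψ) : gradient (φ - ψ) = gradient φ - gradient ψ := by
  ext1 x
  simp only [gradient, Pi.sub_apply]
  rw [fderiv_sub (hφ x) (hψ x), map_sub]

theorem gradient_const_smul {N : ℕ} {φ : EuclideanSpace ℝ (Fin N) → ℝ} (hφ : Differentiable ℝ φ)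
    (c : ℝ) : gradient (c • φ) = c • gradient φ := by
  ext1 x
  simp only [gradient, Pi.smul_apply]
  rw [fderiv_const_smul (hφ x), map_smulₛₗ]
  simp

theorem SA.isRadialTest {N : ℕ} {p : ℝ} {A : ℝ → ℝ} {φ : EuclideanSpace ℝ (Fin N) → ℝ}
    (h : φ ∈ SA N p A) : IsRadialTest φ := ⟨h.1, h.2.1, h.2.2.1⟩

theorem SA.differentiable {N : ℕ} {p : ℝ} {A : ℝ → ℝ} {φ : EuclideanSpace ℝ (Fin N) → ℝ}
    (h : φ ∈ SA N p A) : Differentiable ℝ φ := h.1.differentiable (by simp)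

theorem SA.memLp_gradient {N : ℕ} {p : ℝ} {A : ℝ → ℝ} {φ : EuclideanSpace ℝ (Fin N) → ℝ}
    (h : φ ∈ SA N p A) : MemLp (gradient φ) (ENNReal.ofReal p) (radialMeasure N A) :=
  ⟨(continuous_gradient h.1).aestronglyMeasurable, h.2.2.2⟩

/-- An approximating sequence of `u`, whose gradients converge to `G` in the weighted norm. -/
structure IsApprox {N : ℕ} (p : ℝ) (A : ℝ → ℝ) (u : EuclideanSpace ℝ (Fin N) → ℝ)
    (φ : ℕ → EuclideanSpace ℝ (Fin N) → ℝ)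
    (G : EuclideanSpace ℝ (Fin N) → EuclideanSpace ℝ (Fin N)) : Prop where
  mem : ∀ n, φ n ∈ SA N p A
  memLp : MemLp G (ENNReal.ofReal p) (radialMeasure N A)
  tendsto_gradient : Tendsto
    (fun n => eLpNorm (gradient (φ n) - G) (ENNReal.ofReal p) (radialMeasure N A)) atTop (𝓝 0)
  tendsto_ae : ∀ᵐ x, Tendsto (fun n => φ n x) atTop (𝓝 (u x))

/-- The gradients of a defining sequence are Cauchy in a weighted `L^p` space of vector fields; `G`
is their limit, by completeness. -/
theorem exists_isApprox {N : ℕ} {p : ℝ} (hp : 1 < p) {A : ℝ → ℝ}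
    {u : EuclideanSpace ℝ (Fin N) → ℝ} (hu : u ∈ DA N p A) :
    ∃ φ G, IsApprox p A u φ G := by
  obtain ⟨φ, hφ, hcau, hlim⟩ := hu
  have : Fact (1 ≤ ENNReal.ofReal p) := ⟨by simpa using hp.le⟩
  have hL : ∀ n, MemLp (gradient (φ n)) (ENNReal.ofReal p) (radialMeasure N A) :=
    fun n => SA.memLp_gradient (hφ n)
  have hc : CauchySeq fun n => (hL n).toLp := by
    refine EMetric.cauchySeq_iff.2 fun ε hε => ?_
    obtain ⟨δ, hδ, hδε⟩ := ENNReal.lt_iff_exists_nnreal_btwn.1 hε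
    obtain ⟨n₀, hn₀⟩ := hcau δ (by exact_mod_cast hδ)
    refine ⟨n₀, fun m hm n hn => ?_⟩
    rw [Lp.edist_toLp_toLp, ← gradient_sub (SA.differentiable (hφ m)) (SA.differentiable (hφ n))]
    exact (hn₀ m hm n hn).trans_lt (by simpa using hδε)
  obtain ⟨L, hLlim⟩ := cauchySeq_tendsto_of_complete hc
  refine ⟨φ, L, hφ, Lp.memLp L, ?_, hlim⟩
  rw [Lp.tendsto_Lp_iff_tendsto_eLpNorm'] at hLlim
  refine hLlim.congr fun n => eLpNorm_congr_ae ?_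
  exact (hL n).coeFn_toLp.sub .rfl

theorem IsApprox.tendsto_eLpNorm {N : ℕ} {p : ℝ} (hp : 1 < p) {A : ℝ → ℝ}
    {u : EuclideanSpace ℝ (Fin N) → ℝ} {φ : ℕ → EuclideanSpace ℝ (Fin N) → ℝ}
    {G : EuclideanSpace ℝ (Fin N) → EuclideanSpace ℝ (Fin N)} (h : IsApprox p A u φ G) :
    Tendsto (fun n => eLpNorm (gradient (φ n)) (ENNReal.ofReal p) (radialMeasure N A)) atTop
      (𝓝 (eLpNorm G (ENNReal.ofReal p) (radialMeasure N A))) := by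
  have hp1 : (1 : ℝ≥0∞) ≤ ENNReal.ofReal p := by simpa using hp.le
  set μ := radialMeasure N A
  set P := ENNReal.ofReal p
  have hm : ∀ n, AEStronglyMeasurable (gradient (φ n)) μ := fun n => (SA.memLp_gradient (h.mem n)).1
  have hG := h.memLp.1
  have hGt := h.memLp.2.ne
  have hup : ∀ n, eLpNorm (gradient (φ n)) P μ ≤ eLpNorm G P μ + eLpNorm (gradient (φ n) - G) P μ :=
    fun n => by
      have := eLpNorm_add_le hG ((hm n).sub hG) hp1
      rwa [add_sub_cancel] at this
  have hlo : ∀ n, eLpNorm G P μ - eLpNorm (gradient (φ n) - G) P μ ≤ eLpNorm (gradient (φ n)) P μ :=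
    fun n => by
      have := eLpNorm_sub_le (hm n) ((hm n).sub hG) hp1
      rw [sub_sub_cancel] at this
      exact tsub_le_iff_right.2 this
  refine tendsto_of_tendsto_of_tendsto_of_le_of_le ?_ ?_ hlo hup
  · simpa using ENNReal.Tendsto.sub (tendsto_const_nhds (x := eLpNorm G P μ)) h.tendsto_gradient
      (Or.inl hGt)
  · simpa using (tendsto_const_nhds (x := eLpNorm G P μ)).add h.tendsto_gradient

/-! ### Pointwise estimates in `D_A` -/

/-- The radial estimates, on the set `T`, for a function of norm `L`. -/
def RadialBoundsOn {N : ℕ} (p : ℝ) (A : ℝ → ℝ) (T : Set (EuclideanSpace ℝ (Fin N)))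
    (u : EuclideanSpace ℝ (Fin N) → ℝ) (L : ℝ≥0∞) : Prop :=
  (∀ x ∈ T, ‖u x‖ₑ ≤ oscConst N p A (Ici ‖x‖) * L) ∧
  ∀ x ∈ T, ∀ y ∈ T, ‖x‖ ≤ ‖y‖ → ‖u y - u x‖ₑ ≤ oscConst N p A (Icc ‖x‖ ‖y‖) * L

/-- The bounds for test functions pass to the limit at each point of convergence, so they hold for
the given representative `u` and no continuous one has to be chosen. -/
theorem IsApprox.radialBoundsOn {N : ℕ} (hN : 3 ≤ N) {p : ℝ} (hp : 1 < p) {A : ℝ → ℝ}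
    (hA : HypA N p A)
    {u : EuclideanSpace ℝ (Fin N) → ℝ} {φ : ℕ → EuclideanSpace ℝ (Fin N) → ℝ}
    {G : EuclideanSpace ℝ (Fin N) → EuclideanSpace ℝ (Fin N)} (h : IsApprox p A u φ G) :
    RadialBoundsOn p A {x | x ≠ 0 ∧ Tendsto (fun n => φ n x) atTop (𝓝 (u x))} u
      (eLpNorm G (ENNReal.ofReal p) (radialMeasure N A)) := by
  have hfin : ∀ {x : EuclideanSpace ℝ (Fin N)}, x ≠ 0 → oscConst N p A (Ici ‖x‖) ≠ ⊤ :=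
    fun hx => (oscConst_Ici_lt_top hN hp hA (norm_pos_iff.2 hx)).ne
  have hlim := h.tendsto_eLpNorm hp
  refine ⟨fun x hx => ?_, fun x hx y hy hxy => ?_⟩
  · exact le_of_tendsto_of_tendsto' hx.2.enorm
      (ENNReal.Tendsto.const_mul hlim (Or.inr (hfin hx.1)))
      fun n => enorm_le_oscConst hN hp hA.1 hA.2.1 (SA.isRadialTest (h.mem n)) hx.1
  · exact le_of_tendsto_of_tendsto' (hy.2.sub hx.2).enorm
      (ENNReal.Tendsto.const_mul hlim (Or.inr
        (ne_top_of_le_ne_top (hfin hx.1) (oscConst_mono hp Icc_subset_Ici_self))))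
      fun n => enorm_sub_le_oscConst hN hp hA.1 hA.2.1 (SA.isRadialTest (h.mem n)) hx.1 hxy

theorem IsApprox.aestronglyMeasurable {N : ℕ} {p : ℝ} {A : ℝ → ℝ}
    {u : EuclideanSpace ℝ (Fin N) → ℝ} {φ : ℕ → EuclideanSpace ℝ (Fin N) → ℝ}
    {G : EuclideanSpace ℝ (Fin N) → EuclideanSpace ℝ (Fin N)} (h : IsApprox p A u φ G) :
    AEStronglyMeasurable u :=
  aestronglyMeasurable_of_tendsto_ae atTop
    (fun n => (h.mem n).1.continuous.aestronglyMeasurable) h.tendsto_ae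

/-- The constants of the radial estimate are bounded on compact sets that avoid the origin. -/
theorem exists_bound_on_compact {N : ℕ} (hN : 3 ≤ N) {p : ℝ} (hp : 1 < p) {A : ℝ → ℝ}
    (hA : HypA N p A) {C : Set (EuclideanSpace ℝ (Fin N))} (hC : IsCompact C) (hC0 : C ⊆ {0}ᶜ) :
    ∃ b : ℝ≥0∞, b ≠ ⊤ ∧ ∀ x ∈ C, oscConst N p A (Ici ‖x‖) ≤ b := by
  obtain ⟨m, hm, hmC⟩ := hC.exists_forall_le' (f := fun x => ‖x‖) (a := 0)
    continuous_norm.continuousOn fun x hx => norm_pos_iff.2 (hC0 hx)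
  exact ⟨_, (oscConst_Ici_lt_top hN hp hA hm).ne,
    fun x hx => oscConst_mono hp (Ici_subset_Ici.2 (hmC x hx))⟩

/-- Integration by parts holds for each `φ n` and passes to the limit: the left side by dominated
convergence, using the pointwise bound on the support of `ψ`, and the right side by local `L^1`
convergence of the gradients. -/
theorem IsApprox.isWeakGradient {N : ℕ} (hN : 3 ≤ N) {p : ℝ} (hp : 1 < p) {A : ℝ → ℝ}
    (hA : HypA N p A)
    {u : EuclideanSpace ℝ (Fin N) → ℝ} {φ : ℕ → EuclideanSpace ℝ (Fin N) → ℝ}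
    {G : EuclideanSpace ℝ (Fin N) → EuclideanSpace ℝ (Fin N)} (h : IsApprox p A u φ G) :
    IsWeakGradient u G := by
  have : Nonempty (Fin N) := ⟨⟨0, by omega⟩⟩
  have hopen : IsLocallyClosed ({0}ᶜ : Set (EuclideanSpace ℝ (Fin N))) :=
    isOpen_compl_singleton.isLocallyClosed
  set L := eLpNorm G (ENNReal.ofReal p) (radialMeasure N A) with hL
  have hLt : L ≠ ⊤ := h.memLp.2.ne
  have hne : ∀ᵐ x : EuclideanSpace ℝ (Fin N), x ≠ 0 :=
    compl_mem_ae_iff.2 (measure_singleton (0 : EuclideanSpace ℝ (Fin N)))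
  have hbd := h.radialBoundsOn hN hp hA
  refine ⟨(locallyIntegrableOn_iff hopen).2 fun C hC0 hC => ?_,
    (locallyIntegrableOn_iff hopen).2 fun C hC0 hC => ?_, fun ψ hψ hψc hψ0 i => ?_⟩
  · obtain ⟨b, hb, hbC⟩ := exists_bound_on_compact hN hp hA hC hC0
    refine Measure.integrableOn_of_bounded (M := (b * L).toReal) hC.measure_lt_top.ne
      h.aestronglyMeasurable ?_
    filter_upwards [ae_restrict_of_ae hne, ae_restrict_of_ae h.tendsto_ae,
      ae_restrict_mem hC.measurableSet] with x hx hxt hxC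
    rw [← toReal_enorm]
    refine ENNReal.toReal_mono (ENNReal.mul_ne_top hb hLt) ((hbd.1 x ⟨hx, hxt⟩).trans ?_)
    gcongr
    exact hbC x hxC
  · obtain ⟨c, -, hc⟩ := exists_eLpNorm_one_restrict_le hp hA.1 hA.2.1 hC hC0
    exact (hc G h.memLp).1
  · set v : EuclideanSpace ℝ (Fin N) := EuclideanSpace.single i 1
    have hibp : ∀ n, ∫ x, φ n x * fderiv ℝ ψ x v = -∫ x, gradient (φ n) x i * ψ x := fun n => by
      have hφ := h.mem n
      have hdφ : Continuous fun x => fderiv ℝ (φ n) x v :=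
        (hφ.1.continuous_fderiv (by simp)).clm_apply continuous_const
      have hdψ : Continuous fun x => fderiv ℝ ψ x v :=
        (hψ.continuous_fderiv (by simp)).clm_apply continuous_const
      simp only [gradient_apply]
      refine integral_mul_fderiv_eq_neg_fderiv_mul_of_integrable ?_ ?_ ?_
        (fun x _ => SA.differentiable hφ x) (fun x _ => hψ.differentiable (by simp) x)
      · exact (hdφ.mul hψ.continuous).integrable_of_hasCompactSupport hψc.mul_left
      · exact (hφ.1.continuous.mul hdψ).integrable_of_hasCompactSupport hφ.2.1.mul_right
      · exact (hφ.1.continuous.mul hψ.continuous).integrable_of_hasCompactSupport hψc.mul_left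
    have hl : Tendsto (fun n => ∫ x, φ n x * fderiv ℝ ψ x v) atTop
        (𝓝 (∫ x, u x * fderiv ℝ ψ x v)) := by
      obtain ⟨b, hb, hbC⟩ := exists_bound_on_compact hN hp hA hψc.isCompact hψ0
      have hdψ : Continuous fun x => fderiv ℝ ψ x v :=
        (hψ.continuous_fderiv (by simp)).clm_apply continuous_const
      have hcs : HasCompactSupport fun x => fderiv ℝ ψ x v := hψc.fderiv_apply ℝ v
      have hb1 : b * (L + 1) ≠ ⊤ := ENNReal.mul_ne_top hb (by simp [hLt])
      refine tendsto_integral_filter_of_dominated_convergence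
        (fun x => (b * (L + 1)).toReal * ‖fderiv ℝ ψ x v‖) ?_ ?_ ?_ ?_
      · exact .of_forall fun n => ((h.mem n).1.continuous.mul hdψ).aestronglyMeasurable
      -- The norms of the gradients are eventually below `L + 1`, which makes the pointwise bound
      -- uniform in `n`.
      · have hev := (h.tendsto_eLpNorm hp).eventually_lt_const
          (show L < L + 1 from ENNReal.lt_add_right hLt one_ne_zero)
        filter_upwards [hev] with n hn
        refine .of_forall fun x => ?_
        rw [norm_mul]
        by_cases hx : x ∈ tsupport ψ
        · gcongr
          rw [← toReal_enorm]
          refine ENNReal.toReal_mono hb1 ((enorm_le_oscConst hN hp hA.1 hA.2.1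
            (SA.isRadialTest (h.mem n)) (hψ0 hx)).trans ?_)
          gcongr
          exact hbC x hx
        · have : fderiv ℝ ψ x = 0 := by
            by_contra hne
            exact hx (support_fderiv_subset ℝ hne)
          simp [this]
      · exact ((hdψ.norm).integrable_of_hasCompactSupport hcs.norm).const_mul _
      · filter_upwards [h.tendsto_ae] with x hx
        exact hx.mul_const _
    have hr : Tendsto (fun n => ∫ x, gradient (φ n) x i * ψ x) atTop
        (𝓝 (∫ x, G x i * ψ x)) := by
      obtain ⟨c, hc, hcC⟩ := exists_eLpNorm_one_restrict_le hp hA.1 hA.2.1 hψc.isCompact hψ0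
      obtain ⟨M, hM⟩ := hψc.exists_bound_of_continuous hψ.continuous
      have hint : ∀ H : EuclideanSpace ℝ (Fin N) → EuclideanSpace ℝ (Fin N),
          MemLp H (ENNReal.ofReal p) (radialMeasure N A) →
          Integrable fun x => H x i * ψ x := fun H hH => by
        have h1 : IntegrableOn (fun x => H x i) (tsupport ψ) :=
          (EuclideanSpace.proj (𝕜 := ℝ) i).integrable_comp (hcC H hH).1
        have h2 : IntegrableOn (fun x => H x i * ψ x) (tsupport ψ) :=
          h1.mul_continuousOn hψ.continuous.continuousOn hψc.isCompact
        exact (integrableOn_iff_integrable_of_support_subset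
          ((Function.support_mul_subset_right _ _).trans (subset_tsupport _))).1 h2
      refine tendsto_integral_of_L1' _ (hint G h.memLp).1
        (.of_forall fun n => hint _ (SA.memLp_gradient (h.mem n))) ?_
      have hz : Tendsto (fun n => ENNReal.ofReal M * (c *
          eLpNorm (gradient (φ n) - G) (ENNReal.ofReal p) (radialMeasure N A))) atTop (𝓝 0) := by
        have := ENNReal.Tendsto.const_mul (a := ENNReal.ofReal M)
          (ENNReal.Tendsto.const_mul (a := c) h.tendsto_gradient (Or.inr hc))
          (Or.inr ENNReal.ofReal_ne_top)
        simpa using this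
      refine tendsto_of_tendsto_of_tendsto_of_le_of_le tendsto_const_nhds hz
        (fun n => zero_le) fun n => ?_
      refine le_trans ?_ (mul_le_mul_right
        (hcC _ ((SA.memLp_gradient (h.mem n)).sub h.memLp)).2 _)
      rw [eLpNorm_one_eq_lintegral_enorm, eLpNorm_one_eq_lintegral_enorm,
        ← lintegral_const_mul' _ _ ENNReal.ofReal_ne_top,
        ← lintegral_indicator hψc.isCompact.measurableSet]
      refine lintegral_mono fun x => ?_
      by_cases hx : x ∈ tsupport ψ
      · rw [indicator_of_mem hx]
        simp only [Pi.sub_apply]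
        rw [← sub_mul, enorm_mul, mul_comm]
        gcongr
        · rw [← ofReal_norm]
          exact ENNReal.ofReal_le_ofReal (hM x)
        · rw [enorm_le_iff_norm_le]
          exact PiLp.norm_apply_le (gradient (φ n) x - G x) i
      · simp [image_eq_zero_of_notMem_tsupport hx]
    exact tendsto_nhds_unique hl (by simpa only [hibp] using hr.neg)

theorem DA.exists_isWeakGradient {N : ℕ} (hN : 3 ≤ N) {p : ℝ} (hp : 1 < p) {A : ℝ → ℝ}
    (hA : HypA N p A) {u : EuclideanSpace ℝ (Fin N) → ℝ} (hu : u ∈ DA N p A) :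
    ∃ G, IsWeakGradient u G := by
  obtain ⟨φ, G, h⟩ := exists_isApprox hp hu
  exact ⟨G, h.isWeakGradient hN hp hA⟩

theorem DA.normA_lt_top {N : ℕ} (hN : 3 ≤ N) {p : ℝ} (hp : 1 < p) {A : ℝ → ℝ}
    (hA : HypA N p A) {u : EuclideanSpace ℝ (Fin N) → ℝ} (hu : u ∈ DA N p A) :
    normA N p A u < ⊤ := by
  obtain ⟨φ, G, h⟩ := exists_isApprox hp hu
  rw [(h.isWeakGradient hN hp hA).normA_eq hN]
  exact h.memLp.2

theorem DA.aestronglyMeasurable {N : ℕ} {p : ℝ} (hp : 1 < p) {A : ℝ → ℝ}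
    {u : EuclideanSpace ℝ (Fin N) → ℝ} (hu : u ∈ DA N p A) : AEStronglyMeasurable u := by
  obtain ⟨φ, G, h⟩ := exists_isApprox hp hu
  exact h.aestronglyMeasurable

theorem DA.exists_radialBoundsOn {N : ℕ} (hN : 3 ≤ N) {p : ℝ} (hp : 1 < p) {A : ℝ → ℝ}
    (hA : HypA N p A) {u : EuclideanSpace ℝ (Fin N) → ℝ} (hu : u ∈ DA N p A) :
    ∃ T : Set (EuclideanSpace ℝ (Fin N)), (∀ᵐ x, x ∈ T) ∧ 0 ∉ T ∧
      RadialBoundsOn p A T u (normA N p A u) := by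
  have : Nonempty (Fin N) := ⟨⟨0, by omega⟩⟩
  obtain ⟨φ, G, h⟩ := exists_isApprox hp hu
  refine ⟨_, ?_, ?_, (h.isWeakGradient hN hp hA).normA_eq (p := p) (A := A) hN ▸
    h.radialBoundsOn hN hp hA⟩
  · filter_upwards [h.tendsto_ae,
      compl_mem_ae_iff.2 (measure_singleton (0 : EuclideanSpace ℝ (Fin N)))] with x hx hx0
    exact ⟨hx0, hx⟩
  · simp

/-! ### Scaling -/

theorem SA.const_smul {N : ℕ} {p : ℝ} {A : ℝ → ℝ} {φ : EuclideanSpace ℝ (Fin N) → ℝ}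
    (h : φ ∈ SA N p A) (c : ℝ) : c • φ ∈ SA N p A := by
  refine ⟨h.1.const_smul c, h.2.1.mono (Function.support_const_smul_subset c φ), fun x y hxy => ?_, ?_⟩
  · simp [h.2.2.1 x y hxy]
  · rw [gradient_const_smul (SA.differentiable h)]
    exact ((SA.memLp_gradient h).const_smul c).2

theorem DA.const_smul {N : ℕ} {p : ℝ} {A : ℝ → ℝ} {u : EuclideanSpace ℝ (Fin N) → ℝ}
    (h : u ∈ DA N p A) (c : ℝ) : c • u ∈ DA N p A := by
  obtain ⟨φ, hφ, hcau, hlim⟩ := h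
  refine ⟨fun n => c • φ n, fun n => SA.const_smul (hφ n) c, fun ε hε => ?_, ?_⟩
  -- The summand `1` covers `c = 0`.
  · obtain ⟨n₀, hn₀⟩ := hcau (ε / (|c| + 1)) (by positivity)
    refine ⟨n₀, fun m hm n hn => ?_⟩
    rw [← smul_sub, gradient_const_smul
      ((SA.differentiable (hφ m)).sub (SA.differentiable (hφ n))), eLpNorm_const_smul]
    refine (mul_le_mul_right (hn₀ m hm n hn) _).trans ?_
    rw [← ofReal_norm, ← ENNReal.ofReal_mul (norm_nonneg _)]
    refine ENNReal.ofReal_le_ofReal ?_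
    rw [Real.norm_eq_abs, mul_div_assoc', div_le_iff₀ (by positivity)]
    nlinarith [abs_nonneg c]
  · filter_upwards [hlim] with x hx
    exact hx.const_smul c

theorem DA.normA_const_smul {N : ℕ} (hN : 3 ≤ N) {p : ℝ} (hp : 1 < p) {A : ℝ → ℝ}
    (hA : HypA N p A) {u : EuclideanSpace ℝ (Fin N) → ℝ} (hu : u ∈ DA N p A) (c : ℝ) :
    normA N p A (c • u) = ‖c‖ₑ * normA N p A u := by
  obtain ⟨G, hG⟩ := DA.exists_isWeakGradient hN hp hA hu
  rw [hG.normA_eq hN, (hG.const_smul c).normA_eq hN, eLpNorm_const_smul]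

theorem X.const_smul {N : ℕ} {p : ℝ} {A V : ℝ → ℝ} {u : EuclideanSpace ℝ (Fin N) → ℝ}
    (hu : u ∈ X N p A V) (c : ℝ) : c • u ∈ X N p A V :=
  ⟨DA.const_smul hu.1 c, hu.2.const_smul c⟩

theorem X.normX_const_smul {N : ℕ} (hN : 3 ≤ N) {p : ℝ} (hp : 1 < p) {A V : ℝ → ℝ}
    (hA : HypA N p A) {u : EuclideanSpace ℝ (Fin N) → ℝ} (hu : u ∈ X N p A V) (c : ℝ) :
    normX N p A V (c • u) = ‖c‖ₑ * normX N p A V u := by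
  have hp0 : 0 < p := by linarith
  rw [normX, normX, DA.normA_const_smul hN hp hA hu.1, eLpNorm_const_smul,
    ENNReal.mul_rpow_of_nonneg _ _ hp0.le, ENNReal.mul_rpow_of_nonneg _ _ hp0.le, ← mul_add,
    ENNReal.mul_rpow_of_nonneg _ _ (by positivity), ← ENNReal.rpow_mul,
    mul_one_div_cancel hp0.ne', ENNReal.rpow_one]

theorem X.normX_lt_top {N : ℕ} (hN : 3 ≤ N) {p : ℝ} (hp : 1 < p) {A V : ℝ → ℝ}
    (hA : HypA N p A) {u : EuclideanSpace ℝ (Fin N) → ℝ} (hu : u ∈ X N p A V) :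
    normX N p A V u < ⊤ := by
  have hp0 : 0 < p := by linarith
  refine ENNReal.rpow_lt_top_of_nonneg (by positivity) (ENNReal.add_ne_top.2 ⟨?_, ?_⟩)
  · exact ENNReal.rpow_ne_top_of_nonneg hp0.le (DA.normA_lt_top hN hp hA hu.1).ne
  · exact ENNReal.rpow_ne_top_of_nonneg hp0.le hu.2.2.ne

theorem normA_le_normX {N : ℕ} {p : ℝ} (hp : 1 < p) (A V : ℝ → ℝ)
    (u : EuclideanSpace ℝ (Fin N) → ℝ) : normA N p A u ≤ normX N p A V u := by
  have hp0 : 0 < p := by linarith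
  calc _ = (normA N p A u ^ p) ^ (1 / p) := by
        rw [← ENNReal.rpow_mul, mul_one_div_cancel hp0.ne', ENNReal.rpow_one]
    _ ≤ _ := by
        unfold normX
        gcongr
        exact le_self_add

/-! ### Local finiteness of `K(|x|) dx` away from the origin -/

/-- By polar coordinates a null set of radii has a null preimage in `ℝ^N`. This permits replacing
the merely a.e. measurable `K` by a measurable version. -/
theorem ae_norm_of_ae {N : ℕ} (hN : 3 ≤ N) {P : ℝ → Prop}
    (h : ∀ᵐ t ∂volume.restrict (Ioi (0 : ℝ)), P t) :
    ∀ᵐ x : EuclideanSpace ℝ (Fin N), P ‖x‖ := by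
  have hq : Measure.map (fun x : EuclideanSpace ℝ (Fin N) => ‖x‖) volume ≪
      volume.restrict (Ioi (0 : ℝ)) := by
    refine Measure.AbsolutelyContinuous.mk fun Z hZ hZ0 => ?_
    rw [Measure.map_apply measurable_norm hZ, ← lintegral_indicator_one (measurable_norm hZ)]
    have := lintegral_norm_eq hN (f := Z.indicator 1) (measurable_one.indicator hZ)
    refine Eq.trans this ?_
    have h0 : ∀ᵐ t ∂volume.restrict (Ioi (0 : ℝ)), t ∉ Z := measure_eq_zero_iff_ae_notMem.1 hZ0
    rw [lintegral_congr_ae (g := 0) (by filter_upwards [h0] with t ht; simp [ht])]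
    simp
  exact ae_of_ae_map measurable_norm.aemeasurable (hq.ae_le h)

/-- `K` is integrable on `[r, R]`, since `s > 1`, and the Jacobian is at most `R ^ (N - 1)` there.
-/
theorem radialMeasure_annulus_lt_top {N : ℕ} (hN : 3 ≤ N) {K : ℝ → ℝ} (hK : HypK K) {r R : ℝ}
    (hr : 0 < r) :
    radialMeasure N K (Metric.ball 0 R \ Metric.ball 0 r) < ⊤ := by
  obtain ⟨hKm, -, s, hs, hKs⟩ := hK
  have hI : Icc r R ⊆ Ioi 0 := fun t ht => hr.trans_le ht.1
  have hKint : ∫⁻ t in Icc r R, ENNReal.ofReal (K t) < ⊤ := by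
    have h1 : MemLp K (ENNReal.ofReal s) (volume.restrict (Icc r R)) := hKs _ isCompact_Icc hI
    have h2 : IntegrableOn K (Icc r R) := h1.integrable (by simpa using hs.le)
    exact h2.setLIntegral_lt_top
  set f : ℝ → ℝ≥0∞ := (Icc r R).indicator fun t => ENNReal.ofReal (K t) with hf
  have hfm : AEMeasurable f (volume.restrict (Ioi 0)) := hKm.ennreal_ofReal.indicator measurableSet_Icc
  have hms : MeasurableSet (Metric.ball (0 : EuclideanSpace ℝ (Fin N)) R \ Metric.ball 0 r) :=
    measurableSet_ball.diff measurableSet_ball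
  rw [radialMeasure, withDensity_apply _ hms, ← lintegral_indicator hms]
  calc _ ≤ ∫⁻ x : EuclideanSpace ℝ (Fin N), f ‖x‖ := by
        refine lintegral_mono (indicator_le (g := fun x => f ‖x‖) fun y hy => ?_)
        have : ‖y‖ ∈ Icc r R := by
          simp only [Set.mem_sdiff, Metric.mem_ball, dist_zero_right, not_lt] at hy
          exact ⟨hy.2, hy.1.le⟩
        rw [hf, indicator_of_mem this]
    _ = ∫⁻ x : EuclideanSpace ℝ (Fin N), hfm.mk f ‖x‖ :=
        lintegral_congr_ae (ae_norm_of_ae hN hfm.ae_eq_mk)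
    _ = sphereMass N * ∫⁻ t in Ioi (0 : ℝ), ENNReal.ofReal (t ^ (N - 1)) * hfm.mk f t :=
        lintegral_norm_eq hN hfm.measurable_mk
    _ = sphereMass N * ∫⁻ t in Ioi (0 : ℝ), ENNReal.ofReal (t ^ (N - 1)) * f t := by
        congr 1
        refine lintegral_congr_ae ?_
        filter_upwards [hfm.ae_eq_mk] with t ht
        rw [ht]
    _ ≤ sphereMass N * ∫⁻ t, (Icc r R).indicator
          (fun t => ENNReal.ofReal (R ^ (N - 1)) * ENNReal.ofReal (K t)) t := by
        refine mul_le_mul_right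
          ((setLIntegral_le_lintegral _ _).trans (lintegral_mono fun t => ?_)) _
        by_cases ht : t ∈ Icc r R
        · simp only [hf, indicator_of_mem ht]
          gcongr
          · exact hr.le.trans ht.1
          · exact ht.2
        · simp [hf, indicator_of_notMem ht]
    _ = sphereMass N * (ENNReal.ofReal (R ^ (N - 1)) * ∫⁻ t in Icc r R, ENNReal.ofReal (K t)) := by
        rw [lintegral_indicator measurableSet_Icc, lintegral_const_mul' _ _ ENNReal.ofReal_ne_top]
    _ < ⊤ := ENNReal.mul_lt_top (sphereMass_ne_top N).lt_top
        (ENNReal.mul_lt_top ENNReal.ofReal_lt_top hKint)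

/-! ### The norm of the sum space -/

theorem eLpNorm_restrict_ball_le {E : Type*} [NormedAddCommGroup E] [MeasurableSpace E]
    [OpensMeasurableSpace E] {μ : Measure E} {f : E → ℝ} (hf : AEStronglyMeasurable f μ)
    {q : ℝ≥0∞} (hq : 1 ≤ q) {r R : ℝ} (hrR : r ≤ R) :
    eLpNorm f q (μ.restrict (Metric.ball 0 R)) ≤
      eLpNorm f q (μ.restrict (Metric.ball 0 r)) +
      eLpNorm f q (μ.restrict (Metric.ball 0 R \ Metric.ball 0 r)) := by
  have hm : MeasurableSet (Metric.ball (0 : E) R \ Metric.ball 0 r) :=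
    measurableSet_ball.diff measurableSet_ball
  have hsub : Metric.ball (0 : E) r ⊆ Metric.ball 0 R := Metric.ball_subset_ball hrR
  rw [← eLpNorm_indicator_eq_eLpNorm_restrict measurableSet_ball,
    ← eLpNorm_indicator_eq_eLpNorm_restrict measurableSet_ball,
    ← eLpNorm_indicator_eq_eLpNorm_restrict hm]
  have : (Metric.ball (0 : E) R).indicator f = (Metric.ball (0 : E) r).indicator f +
      (Metric.ball (0 : E) R \ Metric.ball 0 r).indicator f := by
    refine Eq.trans ?_ (indicator_union_of_disjoint disjoint_sdiff_right f)
    rw [union_sdiff_cancel hsub]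
  rw [this]
  exact eLpNorm_add_le (hf.indicator measurableSet_ball) (hf.indicator hm) hq

theorem isDecomposition_indicator {N : ℕ} {K : ℝ → ℝ} {q₁ q₂ : ℝ}
    {f : EuclideanSpace ℝ (Fin N) → ℝ} (hf : AEStronglyMeasurable f (radialMeasure N K))
    {B : Set (EuclideanSpace ℝ (Fin N))} (hB : MeasurableSet B)
    (h₁ : eLpNorm f (ENNReal.ofReal q₁) ((radialMeasure N K).restrict B) < ⊤)
    (h₂ : eLpNorm f (ENNReal.ofReal q₂) ((radialMeasure N K).restrict Bᶜ) < ⊤) :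
    IsDecomposition N K q₁ q₂ f (B.indicator f) (Bᶜ.indicator f) := by
  refine ⟨⟨hf.indicator hB, ?_⟩, ⟨hf.indicator hB.compl, ?_⟩, ?_⟩
  · rwa [eLpNorm_indicator_eq_eLpNorm_restrict hB]
  · rwa [eLpNorm_indicator_eq_eLpNorm_restrict hB.compl]
  · rw [indicator_self_add_compl]

/-- Cutting at the radii `R₁` (inside) and `R₂` (outside) gives a bound in the sum space. -/
theorem sumNorm_le_of_split {N : ℕ} {K : ℝ → ℝ} {q₁ q₂ : ℝ} (hq₁ : 1 < q₁)
    {f : EuclideanSpace ℝ (Fin N) → ℝ} (hf : AEStronglyMeasurable f (radialMeasure N K))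
    (R₁ R₂ : ℝ) {a b c : ℝ≥0∞} (ha : a ≠ ⊤) (hb : b ≠ ⊤) (hc : c ≠ ⊤)
    (h₀ : eLpNorm f (ENNReal.ofReal q₁) ((radialMeasure N K).restrict (Metric.ball 0 R₁)) ≤ a)
    (h₁ : eLpNorm f (ENNReal.ofReal q₁) ((radialMeasure N K).restrict
      (Metric.ball 0 (max R₁ R₂) \ Metric.ball 0 R₁)) ≤ b)
    (h₂ : eLpNorm f (ENNReal.ofReal q₂) ((radialMeasure N K).restrict (Metric.ball 0 R₂)ᶜ) ≤ c) :
    f ∈ sumSpace N K q₁ q₂ ∧ sumNorm N K q₁ q₂ f ≤ max (a + b) c := by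
  -- A single cut at the larger radius works for either order of the radii: the annulus joins the
  -- `q₁` part, and the complement of `B` lies outside the ball of radius `R₂`.
  set B := Metric.ball (0 : EuclideanSpace ℝ (Fin N)) (max R₁ R₂)
  have hin : eLpNorm f (ENNReal.ofReal q₁) ((radialMeasure N K).restrict B) ≤ a + b :=
    (eLpNorm_restrict_ball_le hf (by simpa using hq₁.le) (le_max_left _ _)).trans
      (add_le_add h₀ h₁)
  have hout : eLpNorm f (ENNReal.ofReal q₂) ((radialMeasure N K).restrict Bᶜ) ≤ c :=
    (eLpNorm_mono_measure f (Measure.restrict_mono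
      (compl_subset_compl.2 (Metric.ball_subset_ball (le_max_right _ _))) le_rfl)).trans h₂
  have hB : MeasurableSet B := measurableSet_ball
  have hd := isDecomposition_indicator hf hB
    (hin.trans_lt (ENNReal.add_lt_top.2 ⟨ha.lt_top, hb.lt_top⟩)) (hout.trans_lt hc.lt_top)
  refine ⟨⟨_, _, hd⟩, ?_⟩
  unfold sumNorm
  refine iInf_le_of_le (B.indicator f) (iInf_le_of_le (Bᶜ.indicator f) (iInf_le_of_le hd ?_))
  rw [eLpNorm_indicator_eq_eLpNorm_restrict hB, eLpNorm_indicator_eq_eLpNorm_restrict hB.compl]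
  exact max_le_max hin hout

/-! ### Bounds for elements of `X` -/

/-- Covers the elements that cannot be normalised to the unit sphere; the pointwise bound forces
them to vanish. -/
theorem X.ae_eq_zero_of_normX_eq_zero {N : ℕ} (hN : 3 ≤ N) {p : ℝ} (hp : 1 < p) {A V : ℝ → ℝ}
    (hA : HypA N p A) {u : EuclideanSpace ℝ (Fin N) → ℝ} (hu : u ∈ X N p A V)
    (h : normX N p A V u = 0) : u =ᵐ[volume] 0 := by
  obtain ⟨T, hT, -, hTb⟩ := DA.exists_radialBoundsOn hN hp hA hu.1
  have h0 : normA N p A u = 0 := le_antisymm (h ▸ normA_le_normX hp A V u) zero_le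
  filter_upwards [hT] with x hx
  simpa [h0] using hTb.1 x hx

/-- The supremum of `∫_B K(|x|) |u|^q dx` over the unit sphere of `X` bounds the `L^q` norm on
`B`. -/
theorem X.eLpNorm_restrict_le {N : ℕ} (hN : 3 ≤ N) {p : ℝ} (hp : 1 < p) {A V K : ℝ → ℝ}
    (hA : HypA N p A) {u : EuclideanSpace ℝ (Fin N) → ℝ} (hu : u ∈ X N p A V) {q : ℝ} (hq : 1 < q)
    {B : Set (EuclideanSpace ℝ (Fin N))} {S : ℝ≥0∞}
    (hS : ⨆ u ∈ {u | u ∈ X N p A V ∧ normX N p A V u = 1},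
      ∫⁻ x in B, ‖u x‖ₑ ^ q ∂(radialMeasure N K) ≤ S) :
    eLpNorm u (ENNReal.ofReal q) ((radialMeasure N K).restrict B) ≤
      S ^ (1 / q) * normX N p A V u := by
  have hq0 : 0 < q := by linarith
  set n := normX N p A V u with hn
  have hnt : n ≠ ⊤ := (X.normX_lt_top hN hp hA hu).ne
  rcases eq_or_ne n 0 with h0 | h0
  · have : u =ᵐ[(radialMeasure N K).restrict B] 0 :=
      ae_restrict_of_ae ((radialMeasure_absolutelyContinuous N K).ae_le
        (X.ae_eq_zero_of_normX_eq_zero hN hp hA hu h0))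
    rw [eLpNorm_congr_ae this, eLpNorm_zero]
    exact zero_le
  · set c : ℝ := n.toReal⁻¹
    have hnr : 0 < n.toReal := ENNReal.toReal_pos h0 hnt
    have hc : ‖c‖ₑ = n⁻¹ := by
      rw [← ofReal_norm, Real.norm_of_nonneg (inv_nonneg.2 hnr.le), ENNReal.ofReal_inv_of_pos hnr,
        ENNReal.ofReal_toReal hnt]
    have hmem : c • u ∈ {u | u ∈ X N p A V ∧ normX N p A V u = 1} := by
      refine ⟨X.const_smul hu c, ?_⟩
      rw [X.normX_const_smul hN hp hA hu, hc, ← hn, ENNReal.inv_mul_cancel h0 hnt]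
    have h1 := (le_iSup₂ (f := fun u (_ : u ∈ {u | u ∈ X N p A V ∧ normX N p A V u = 1}) =>
      ∫⁻ x in B, ‖u x‖ₑ ^ q ∂(radialMeasure N K)) _ hmem).trans hS
    have h2 : eLpNorm (c • u) (ENNReal.ofReal q) ((radialMeasure N K).restrict B) ≤
        S ^ (1 / q) := by
      rw [eLpNorm_eq_lintegral_rpow_enorm_toReal (by simpa using hq0) (by simp),
        ENNReal.toReal_ofReal hq0.le]
      exact ENNReal.rpow_le_rpow h1 (by positivity)
    rw [eLpNorm_const_smul, hc] at h2
    calc _ = n⁻¹ * eLpNorm u (ENNReal.ofReal q) ((radialMeasure N K).restrict B) * n := by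
          rw [mul_right_comm, ENNReal.inv_mul_cancel h0 hnt, one_mul]
      _ ≤ _ := by gcongr

theorem enorm_le_on_annulus {N : ℕ} {p : ℝ} (hp : 1 < p) {A : ℝ → ℝ}
    {T : Set (EuclideanSpace ℝ (Fin N))} {u : EuclideanSpace ℝ (Fin N) → ℝ} {L : ℝ≥0∞}
    (hu : RadialBoundsOn p A T u L) {r R : ℝ} {x : EuclideanSpace ℝ (Fin N)} (hxT : x ∈ T)
    (hx : x ∈ Metric.ball (0 : EuclideanSpace ℝ (Fin N)) R \ Metric.ball 0 r) :
    ‖u x‖ₑ ≤ oscConst N p A (Ici r) * L := by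
  simp only [Set.mem_sdiff, Metric.mem_ball, dist_zero_right, not_lt] at hx
  refine (hu.1 x hxT).trans ?_
  gcongr
  exact oscConst_mono hp (Ici_subset_Ici.2 hx.2)

theorem RadialBoundsOn.mono {N : ℕ} {p : ℝ} {A : ℝ → ℝ} {T T' : Set (EuclideanSpace ℝ (Fin N))}
    {u : EuclideanSpace ℝ (Fin N) → ℝ} {L L' : ℝ≥0∞} (h : RadialBoundsOn p A T u L)
    (hT : T' ⊆ T) (hL : L ≤ L') : RadialBoundsOn p A T' u L' :=
  ⟨fun x hx => (h.1 x (hT hx)).trans (by gcongr),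
    fun x hx y hy hxy => (h.2 x (hT hx) y (hT hy) hxy).trans (by gcongr)⟩

theorem continuouslyEmbedded_of_lt_top {N : ℕ} (hN : 3 ≤ N) {p : ℝ} (hp : 1 < p)
    {A V K : ℝ → ℝ} (hA : HypA N p A) (hK : HypK K) {q₁ q₂ : ℝ} (hq₁ : 1 < q₁) (hq₂ : 1 < q₂)
    {R₁ R₂ : ℝ} (hR₁ : 0 < R₁) (h₀ : S₀ N p A V K q₁ R₁ < ⊤) (hi : Sinf N p A V K q₂ R₂ < ⊤) :
    ContinuouslyEmbedded (X N p A V) (normX N p A V) (sumSpace N K q₁ q₂)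
      (sumNorm N K q₁ q₂) := by
  have hq₁0 : 0 < q₁ := by linarith
  have hq₂0 : 0 < q₂ := by linarith
  set a := S₀ N p A V K q₁ R₁ ^ (1 / q₁) with ha
  set c := Sinf N p A V K q₂ R₂ ^ (1 / q₂) with hc
  set m := radialMeasure N K (Metric.ball 0 (max R₁ R₂) \ Metric.ball 0 R₁) ^ q₁⁻¹ with hm
  set b := m * oscConst N p A (Ici R₁) with hb
  have hat : a ≠ ⊤ := ENNReal.rpow_ne_top_of_nonneg (by positivity) h₀.ne
  have hct : c ≠ ⊤ := ENNReal.rpow_ne_top_of_nonneg (by positivity) hi.ne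
  have hbt : b ≠ ⊤ := ENNReal.mul_ne_top
    (ENNReal.rpow_ne_top_of_nonneg (by positivity) (radialMeasure_annulus_lt_top hN hK hR₁).ne)
    (oscConst_Ici_lt_top hN hp hA hR₁).ne
  have key : ∀ u ∈ X N p A V, u ∈ sumSpace N K q₁ q₂ ∧
      sumNorm N K q₁ q₂ u ≤ max (a + b) c * normX N p A V u := by
    intro u hu
    have hnt : normX N p A V u ≠ ⊤ := (X.normX_lt_top hN hp hA hu).ne
    have hmax : max (a + b) c * normX N p A V u =
        max (a * normX N p A V u + b * normX N p A V u) (c * normX N p A V u) := by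
      rw [← add_mul, max_mul]
    rw [hmax]
    refine sumNorm_le_of_split hq₁ ((DA.aestronglyMeasurable hp hu.1).mono_ac
      (radialMeasure_absolutelyContinuous N K)) R₁ R₂ (ENNReal.mul_ne_top hat hnt)
      (ENNReal.mul_ne_top hbt hnt) (ENNReal.mul_ne_top hct hnt)
      (X.eLpNorm_restrict_le hN hp hA hu hq₁ le_rfl) ?_
      (X.eLpNorm_restrict_le hN hp hA hu hq₂ le_rfl)
    obtain ⟨T, hT, -, hTb⟩ := DA.exists_radialBoundsOn hN hp hA hu.1
    have hae : ∀ᵐ x ∂(radialMeasure N K).restrict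
        (Metric.ball 0 (max R₁ R₂) \ Metric.ball 0 R₁),
        ‖u x‖ₑ ≤ oscConst N p A (Ici R₁) * normX N p A V u := by
      filter_upwards [ae_restrict_of_ae ((radialMeasure_absolutelyContinuous N K).ae_le hT),
        ae_restrict_mem (measurableSet_ball.diff measurableSet_ball)] with x hxT hx
      exact enorm_le_on_annulus hp (hTb.mono subset_rfl (normA_le_normX hp A V u)) hxT hx
    refine (eLpNorm_le_of_ae_enorm_bound hae).trans_eq ?_
    rw [Measure.restrict_apply_univ, ENNReal.toReal_ofReal hq₁0.le, smul_eq_mul, hb, hm]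
    ring
  -- Adding `1` makes the embedding constant strictly positive.
  refine ⟨fun u hu => (key u hu).1, (max (a + b) c).toReal + 1, by positivity, fun u hu =>
    (key u hu).2.trans ?_⟩
  gcongr
  have hmt : max (a + b) c ≠ ⊤ := (max_lt (ENNReal.add_lt_top.2 ⟨hat.lt_top, hbt.lt_top⟩) hct.lt_top).ne
  rw [ENNReal.le_ofReal_iff_toReal_le hmt (by positivity)]
  linarith

/-! ### Compactness -/

/-- Radial bounds give a subsequence that converges pointwise on a dense set of points. -/
theorem exists_subseq_tendsto {N : ℕ} (hN : 3 ≤ N) {p : ℝ} (hp : 1 < p) {A : ℝ → ℝ}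
    (hA : HypA N p A) {T : Set (EuclideanSpace ℝ (Fin N))} (hT : Dense T) (hT0 : 0 ∉ T)
    {L : ℝ≥0∞} (hL : L ≠ ⊤) {u : ℕ → EuclideanSpace ℝ (Fin N) → ℝ}
    (hu : ∀ n, RadialBoundsOn p A T (u n) L) :
    ∃ k : ℕ → ℕ, StrictMono k ∧ ∃ v : EuclideanSpace ℝ (Fin N) → ℝ,
      ∀ x ∈ T, Tendsto (fun n => u (k n) x) atTop (𝓝 (v x)) := by
  -- `Q` is dense in the whole space yet contained in `T`, so the radial bounds are available at its
  -- points.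
  obtain ⟨Q, hQT, hQc, hQ⟩ := hT.exists_countable_dense_subset
  have := hQc.to_subtype
  have hne : ∀ x ∈ T, 0 < ‖x‖ := fun x hx => norm_pos_iff.2 fun h => hT0 (h ▸ hx)
  -- A countable product of compact intervals is sequentially compact; this replaces the diagonal
  -- argument.
  have hcomp : IsCompact (Set.pi univ fun y : Q =>
      Metric.closedBall (0 : ℝ) (oscConst N p A (Ici ‖y.1‖) * L).toReal) :=
    isCompact_univ_pi fun y => isCompact_closedBall _ _
  obtain ⟨w, -, k, hk, hw⟩ := hcomp.tendsto_subseq (x := fun n (y : Q) => u n y) fun n y _ => by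
    rw [mem_closedBall_zero_iff, ← toReal_enorm]
    exact ENNReal.toReal_mono (ENNReal.mul_ne_top
      (oscConst_Ici_lt_top hN hp hA (hne y (hQT y.2))).ne hL) ((hu n).1 y (hQT y.2))
  rw [tendsto_pi_nhds] at hw
  have hcau : ∀ x ∈ T, ∃ l, Tendsto (fun n => u (k n) x) atTop (𝓝 l) := fun x hx => by
    refine cauchySeq_tendsto_of_complete (EMetric.cauchySeq_iff.2 fun ε hε => ?_)
    have hε3 : 0 < ε / 3 := ENNReal.div_pos hε.ne' (by simp)
    have hosc : Tendsto (fun s => oscConst N p A (Icc ‖x‖ s) * L) (𝓝[>] ‖x‖) (𝓝 0) := by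
      simpa using ENNReal.Tendsto.mul_const (b := L) (tendsto_oscConst_Icc hN hp hA (hne x hx))
        (Or.inr hL)
    obtain ⟨s, hs, hsε⟩ := (mem_nhdsGT_iff_exists_Ioo_subset).1 (hosc.eventually_lt_const hε3)
    have hs : ‖x‖ < s := hs
    -- Only `‖y‖` matters: any point of `Q` in a thin shell just outside the sphere through `x` has
    -- nearly the same values, uniformly in `n`. The shell is nonempty, as it contains a multiple of
    -- `x` of norm `(‖x‖ + s) / 2`.
    obtain ⟨y, hyQ, hy⟩ := hQ.exists_mem_open
      (isOpen_Ioo.preimage (continuous_norm (E := EuclideanSpace ℝ (Fin N))) :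
        IsOpen (norm ⁻¹' Ioo ‖x‖ s))
      ⟨(((‖x‖ + s) / 2) / ‖x‖) • x, by
        have hx0 := hne x hx
        have hs0 : 0 < s := hx0.trans hs
        rw [mem_preimage, norm_smul, Real.norm_of_nonneg (by positivity),
          div_mul_cancel₀ _ hx0.ne']
        constructor <;> linarith⟩
    have hyx : ∀ n, edist (u n x) (u n y) ≤ ε / 3 := fun n => by
      rw [edist_comm, edist_eq_enorm_sub]
      exact ((hu n).2 x hx y (hQT hyQ) hy.1.le).trans (hsε hy).le
    obtain ⟨n₀, hn₀⟩ := EMetric.cauchySeq_iff.1 (hw ⟨y, hyQ⟩).cauchySeq (ε / 3) hε3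
    refine ⟨n₀, fun m hm n hn => ?_⟩
    by_cases hεt : ε = ⊤
    · rw [hεt]; exact edist_lt_top _ _
    have hε3t : ε / 3 ≠ ⊤ := ENNReal.div_ne_top hεt (by simp)
    calc edist (u (k m) x) (u (k n) x)
        ≤ edist (u (k m) x) (u (k m) y) + edist (u (k m) y) (u (k n) y) +
          edist (u (k n) y) (u (k n) x) := edist_triangle4 _ _ _ _
      _ < ε / 3 + ε / 3 + ε / 3 := by
          refine ENNReal.add_lt_add_of_lt_of_le ?_ ?_ (by rw [edist_comm]; exact hyx _)
          · rw [edist_comm]; exact ne_top_of_le_ne_top hε3t (hyx _)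
          · exact ENNReal.add_lt_add_of_le_of_lt (ne_top_of_le_ne_top hε3t (hyx _)) (hyx _)
              (hn₀ m hm n hn)
      _ = ε := ENNReal.add_thirds ε
  choose! v hv using hcau
  exact ⟨k, hk, v, hv⟩

/-- Dominated convergence: on the annulus `w n` and its limit are both bounded by `M`, and the
constant `(M + M) ^ q` is integrable because the annulus has finite mass. -/
theorem tendsto_eLpNorm_annulus {N : ℕ} (hN : 3 ≤ N) {p : ℝ} (hp : 1 < p) {A K : ℝ → ℝ}
    (hA : HypA N p A) (hK : HypK K) {T : Set (EuclideanSpace ℝ (Fin N))} (hT : ∀ᵐ x, x ∈ T)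
    {L : ℝ≥0∞} (hL : L ≠ ⊤) {w : ℕ → EuclideanSpace ℝ (Fin N) → ℝ}
    {v : EuclideanSpace ℝ (Fin N) → ℝ} (hwm : ∀ n, AEStronglyMeasurable (w n))
    (hw : ∀ n, RadialBoundsOn p A T (w n) L)
    (hv : ∀ x ∈ T, Tendsto (fun n => w n x) atTop (𝓝 (v x)))
    (hvm : AEStronglyMeasurable v) {q : ℝ} (hq : 1 < q) {r R : ℝ} (hr : 0 < r) :
    Tendsto (fun n => eLpNorm (w n - v) (ENNReal.ofReal q) ((radialMeasure N K).restrict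
      (Metric.ball 0 R \ Metric.ball 0 r))) atTop (𝓝 0) := by
  have hq0 : 0 < q := by linarith
  set D := Metric.ball (0 : EuclideanSpace ℝ (Fin N)) R \ Metric.ball 0 r
  set M := oscConst N p A (Ici r) * L
  have hM : M ≠ ⊤ := ENNReal.mul_ne_top (oscConst_Ici_lt_top hN hp hA hr).ne hL
  have hD : MeasurableSet D := measurableSet_ball.diff measurableSet_ball
  have hac : (radialMeasure N K).restrict D ≪ volume :=
    Measure.restrict_le_self.absolutelyContinuous.trans (radialMeasure_absolutelyContinuous N K)
  have hae : ∀ᵐ x ∂(radialMeasure N K).restrict D, x ∈ T ∧ x ∈ D :=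
    Filter.Eventually.and (hac.ae_le hT) (ae_restrict_mem hD)
  have hint : Tendsto (fun n => ∫⁻ x, ‖(w n - v) x‖ₑ ^ q ∂(radialMeasure N K).restrict D) atTop
      (𝓝 (∫⁻ _, 0 ∂(radialMeasure N K).restrict D)) := by
    refine tendsto_lintegral_of_dominated_convergence' (fun _ => (M + M) ^ q) (fun n => ?_)
      (fun n => ?_) ?_ ?_
    · exact (((hwm n).sub hvm).mono_ac hac).enorm.pow_const q
    · filter_upwards [hae] with x hx
      gcongr
      have hwx := fun n => enorm_le_on_annulus hp (hw n) hx.1 hx.2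
      refine enorm_sub_le.trans (add_le_add (hwx n) ?_)
      exact le_of_tendsto' (hv x hx.1).enorm hwx
    · rw [lintegral_const, Measure.restrict_apply_univ]
      exact ENNReal.mul_ne_top
        (ENNReal.rpow_ne_top_of_nonneg hq0.le (ENNReal.add_ne_top.2 ⟨hM, hM⟩))
        (radialMeasure_annulus_lt_top hN hK hr).ne
    · filter_upwards [hae] with x hx
      have h1 : Tendsto (fun n => ‖(w n - v) x‖ₑ) atTop (𝓝 0) := by
        simpa using ((hv x hx.1).sub_const (v x)).enorm
      have h2 := (ENNReal.continuous_rpow_const (y := q)).tendsto 0 |>.comp h1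
      rwa [ENNReal.zero_rpow_of_pos hq0] at h2
  rw [lintegral_zero] at hint
  have h3 := (ENNReal.continuous_rpow_const (y := 1 / q)).tendsto 0 |>.comp hint
  rw [ENNReal.zero_rpow_of_pos (by positivity)] at h3
  refine h3.congr fun n => ?_
  rw [eLpNorm_eq_lintegral_rpow_enorm_toReal (by simpa using hq0) (by simp),
    ENNReal.toReal_ofReal hq0.le]
  rfl

/-- A bounded sequence that converges almost everywhere: the bound passes to the limit and
controls the differences. -/
theorem eLpNorm_sub_limit_le {E : Type*} [MeasurableSpace E] {μ : Measure E}
    {w : ℕ → E → ℝ} {v : E → ℝ} {q B : ℝ≥0∞} (hq : 1 ≤ q)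
    (hw : ∀ n, AEStronglyMeasurable (w n) μ) (hB : ∀ n, eLpNorm (w n) q μ ≤ B)
    (hv : ∀ᵐ x ∂μ, Tendsto (fun n => w n x) atTop (𝓝 (v x))) :
    eLpNorm v q μ ≤ B ∧ ∀ n, eLpNorm (w n - v) q μ ≤ B + B := by
  -- Fatou's lemma.
  have hvB : eLpNorm v q μ ≤ B := Lp.eLpNorm_le_of_ae_tendsto (.of_forall hB) hw hv
  exact ⟨hvB, fun n => (eLpNorm_sub_le (hw n)
    (aestronglyMeasurable_of_tendsto_ae atTop hw hv) hq).trans (add_le_add (hB n) hvB)⟩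

theorem tendsto_rpow_mul_zero {α : Type*} {l : Filter α} {S : α → ℝ≥0∞} (hS : Tendsto S l (𝓝 0))
    {q : ℝ} (hq : 0 < q) {L : ℝ≥0∞} (hL : L ≠ ⊤) :
    Tendsto (fun R => S R ^ (1 / q) * L) l (𝓝 0) := by
  have h := (ENNReal.continuous_rpow_const (y := 1 / q)).tendsto 0 |>.comp hS
  rw [ENNReal.zero_rpow_of_pos (by positivity)] at h
  simpa using ENNReal.Tendsto.mul_const (b := L) h (Or.inr hL)

/-- The limit `v` is not shown to belong to `X`, so its bounds on the inner ball and on the exterior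
come from Fatou's lemma and not from `S₀` and `Sinf` directly. -/
theorem compactlyEmbedded_of_tendsto {N : ℕ} (hN : 3 ≤ N) {p : ℝ} (hp : 1 < p)
    {A V K : ℝ → ℝ} (hA : HypA N p A) (hK : HypK K) {q₁ q₂ : ℝ} (hq₁ : 1 < q₁) (hq₂ : 1 < q₂)
    (h₀ : Tendsto (fun R : ℝ => S₀ N p A V K q₁ R) (𝓝[>] 0) (𝓝 0))
    (hi : Tendsto (fun R : ℝ => Sinf N p A V K q₂ R) atTop (𝓝 0)) :
    CompactlyEmbedded (X N p A V) (normX N p A V) (sumSpace N K q₁ q₂)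
      (sumNorm N K q₁ q₂) := by
  have : Nonempty (Fin N) := ⟨⟨0, by omega⟩⟩
  refine ⟨?_, fun u hu ⟨C, hC⟩ => ?_⟩
  · obtain ⟨R₁, h1, hR₁⟩ := ((h₀.eventually_lt_const ENNReal.zero_lt_top).and
      self_mem_nhdsWithin).exists
    obtain ⟨R₂, h2⟩ := (hi.eventually_lt_const ENNReal.zero_lt_top).exists
    exact continuouslyEmbedded_of_lt_top hN hp hA hK hq₁ hq₂ hR₁ h1 h2
  set L := ENNReal.ofReal C
  have hL : L ≠ ⊤ := ENNReal.ofReal_ne_top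
  -- Each `u n` has its own set of full measure; the countable intersection still has full measure
  -- and is therefore dense.
  choose T hT hT0 hTb using fun n => DA.exists_radialBoundsOn hN hp hA (hu n).1
  have hTae : ∀ᵐ x, x ∈ ⋂ n, T n := by
    simpa only [mem_iInter] using ae_all_iff.2 hT
  have hub : ∀ n, RadialBoundsOn p A (⋂ n, T n) (u n) L := fun n =>
    (hTb n).mono (iInter_subset _ n) ((normA_le_normX hp A V (u n)).trans (hC n))
  obtain ⟨k, hk, v, hv⟩ := exists_subseq_tendsto hN hp hA (Measure.dense_of_ae hTae)
    (fun h => hT0 0 (mem_iInter.1 h 0)) hL hub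
  have hum : ∀ n, AEStronglyMeasurable (u (k n)) := fun n =>
    DA.aestronglyMeasurable hp (hu (k n)).1
  have hvae : ∀ᵐ x, Tendsto (fun n => u (k n) x) atTop (𝓝 (v x)) := by
    filter_upwards [hTae] with x hx using hv x hx
  have hvm : AEStronglyMeasurable v := aestronglyMeasurable_of_tendsto_ae atTop hum hvae
  have hacK := radialMeasure_absolutelyContinuous N K
  have hac : ∀ B, (radialMeasure N K).restrict B ≪ volume := fun B =>
    Measure.restrict_le_self.absolutelyContinuous.trans hacK
  have hin : ∀ R, _ := fun R => eLpNorm_sub_limit_le (q := ENNReal.ofReal q₁)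
    (μ := (radialMeasure N K).restrict (Metric.ball 0 R)) (by simpa using hq₁.le)
    (fun n => (hum n).mono_ac (hac _)) (fun n => (X.eLpNorm_restrict_le hN hp hA (hu (k n)) hq₁
      (S := S₀ N p A V K q₁ R) le_rfl).trans (mul_le_mul_right (hC (k n)) _)) ((hac _).ae_le hvae)
  have hout : ∀ R, _ := fun R => eLpNorm_sub_limit_le (q := ENNReal.ofReal q₂)
    (μ := (radialMeasure N K).restrict (Metric.ball 0 R)ᶜ) (by simpa using hq₂.le)
    (fun n => (hum n).mono_ac (hac _)) (fun n => (X.eLpNorm_restrict_le hN hp hA (hu (k n)) hq₂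
      (S := Sinf N p A V K q₂ R) le_rfl).trans (mul_le_mul_right (hC (k n)) _)) ((hac _).ae_le hvae)
  have hs₀ := tendsto_rpow_mul_zero h₀ (show 0 < q₁ by linarith) hL
  have hsi := tendsto_rpow_mul_zero hi (show 0 < q₂ by linarith) hL
  have hann : ∀ {r R : ℝ}, 0 < r → Tendsto (fun n => eLpNorm (u (k n) - v) (ENNReal.ofReal q₁)
      ((radialMeasure N K).restrict (Metric.ball 0 R \ Metric.ball 0 r))) atTop (𝓝 0) :=
    fun hr => tendsto_eLpNorm_annulus hN hp hA hK hTae hL hum (fun n => hub (k n)) hv hvm hq₁ hr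
  have hmain : ∀ ε : ℝ≥0∞, 0 < ε → ∃ R₁ R₂ : ℝ, 0 < R₁ ∧
      S₀ N p A V K q₁ R₁ ^ (1 / q₁) * L ≤ ε ∧ Sinf N p A V K q₂ R₂ ^ (1 / q₂) * L ≤ ε :=
    fun ε hε => by
      obtain ⟨R₁, h1, hR₁⟩ := ((hs₀.eventually_lt_const hε).and self_mem_nhdsWithin).exists
      obtain ⟨R₂, h2⟩ := (hsi.eventually_lt_const hε).exists
      exact ⟨R₁, R₂, hR₁, h1.le, h2.le⟩
  refine ⟨k, hk, v, ?_, ?_⟩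
  -- Membership of `v` needs only finite bounds, so any finite tolerance would do.
  · obtain ⟨R₁, R₂, hR₁, h1, h2⟩ := hmain 1 one_pos
    refine (sumNorm_le_of_split hq₁ (hvm.mono_ac hacK) R₁ R₂ ENNReal.one_ne_top ?_
      ENNReal.one_ne_top ((hin R₁).1.trans h1) le_rfl ((hout R₂).1.trans h2)).1
    have hae : ∀ᵐ x ∂(radialMeasure N K).restrict
        (Metric.ball 0 (max R₁ R₂) \ Metric.ball 0 R₁),
        ‖v x‖ₑ ≤ oscConst N p A (Ici R₁) * L := by
      filter_upwards [(hac _).ae_le hTae,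
        ae_restrict_mem (measurableSet_ball.diff measurableSet_ball)] with x hxT hx
      exact le_of_tendsto' (hv x hxT).enorm fun n => enorm_le_on_annulus hp (hub (k n)) hxT hx
    refine ne_top_of_le_ne_top ?_ (eLpNorm_le_of_ae_enorm_bound hae)
    rw [Measure.restrict_apply_univ, smul_eq_mul]
    exact ENNReal.mul_ne_top (ENNReal.mul_ne_top (oscConst_Ici_lt_top hN hp hA hR₁).ne hL)
      (ENNReal.rpow_ne_top_of_nonneg (by positivity) (radialMeasure_annulus_lt_top hN hK hR₁).ne)
  · refine ENNReal.tendsto_atTop_zero.2 fun ε hε => ?_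
    -- The ball costs `δ + δ` and the annulus `δ`, hence the three thirds; the exterior costs `δ +
    -- δ`. The radii depend on `δ` alone and are fixed before `n`.
    obtain ⟨δ, hδ, hδε⟩ := ENNReal.lt_iff_exists_nnreal_btwn.1
      (ENNReal.div_pos hε.ne' (show (3 : ℝ≥0∞) ≠ ⊤ by simp))
    have hδt : (δ : ℝ≥0∞) ≠ ⊤ := ENNReal.coe_ne_top
    obtain ⟨R₁, R₂, hR₁, h1, h2⟩ := hmain δ hδ
    obtain ⟨n₀, hn₀⟩ := eventually_atTop.1
      ((hann (R := max R₁ R₂) hR₁).eventually_lt_const hδ)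
    have hle : (δ : ℝ≥0∞) + δ + δ ≤ ε := by
      rw [← ENNReal.add_thirds ε]
      gcongr
    refine ⟨n₀, fun n hn => (sumNorm_le_of_split hq₁ (((hum n).sub hvm).mono_ac hacK) R₁ R₂
      (ENNReal.add_ne_top.2 ⟨hδt, hδt⟩) hδt (ENNReal.add_ne_top.2 ⟨hδt, hδt⟩)
      (((hin R₁).2 n).trans (add_le_add h1 h1)) (hn₀ n hn).le
      (((hout R₂).2 n).trans (add_le_add h2 h2))).2.trans ?_⟩
    exact max_le hle (le_self_add.trans hle)

end RadialEmbedding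

theorem theorem3p1 (N : ℕ) (hN : 3 ≤ N) (p : ℝ) (hp : 1 < p) (hpN : p < N)
    (A V K : ℝ → ℝ) (hA : RadialEmbedding.HypA N p A) (hV : RadialEmbedding.HypV V)
    (hK : RadialEmbedding.HypK K) (q₁ q₂ : ℝ) (hq₁ : 1 < q₁) (hq₂ : 1 < q₂) :
    ((∃ R₁ R₂ : ℝ, 0 < R₁ ∧ 0 < R₂ ∧ RadialEmbedding.S₀ N p A V K q₁ R₁ < ⊤ ∧
        RadialEmbedding.Sinf N p A V K q₂ R₂ < ⊤) →
      RadialEmbedding.ContinuouslyEmbedded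
        (RadialEmbedding.X N p A V) (RadialEmbedding.normX N p A V)
        (RadialEmbedding.sumSpace N K q₁ q₂) (RadialEmbedding.sumNorm N K q₁ q₂)) ∧
    ((Tendsto (fun R : ℝ => RadialEmbedding.S₀ N p A V K q₁ R) (𝓝[>] 0) (𝓝 0) ∧
        Tendsto (fun R : ℝ => RadialEmbedding.Sinf N p A V K q₂ R) atTop (𝓝 0)) →
      RadialEmbedding.CompactlyEmbedded
        (RadialEmbedding.X N p A V) (RadialEmbedding.normX N p A V)
        (RadialEmbedding.sumSpace N K q₁ q₂) (RadialEmbedding.sumNorm N K q₁ q₂)) := by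
  refine ⟨fun ⟨R₁, R₂, hR₁, _, h₀, hi⟩ => ?_, fun ⟨h₀, hi⟩ => ?_⟩
  · exact RadialEmbedding.continuouslyEmbedded_of_lt_top hN hp hA hK hq₁ hq₂ hR₁ h₀ hi
  · exact RadialEmbedding.compactlyEmbedded_of_tendsto hN hp hA hK hq₁ hq₂ h₀ hi
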